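/- Let $\nu$ be a probability measure on the set of probability vectors $(p(-2),p(-1),p(1))$, and let $\omega=(\omega_x)_{x\in\mathbb Z}$ be an i.i.d. environment with law $\mathbb P=\nu^{\otimes\mathbb Z}$. Given $\omega$, let $P_\omega$ be the law of the Markov chain $(X_t)_{t\ge0}$ on $\mathbb Z$ with $X_0=0$ and $P_\omega(X_{t+1}=x+l\mid X_t=x)=\omega_x(l)$ for $l=-2,-1,1$. Put $a_k=\omega_k(-1)/\omega_k(1)$, $b_k=\omega_k(-2)/\omega_k(1)$ and $$A_k=\begin{pmatrix}a_k&b_k&0\\a_k&b_k&1\\a_k&b_k&0\end{pmatrix}.$$ Assume that $\mathbb E\log\omega_0(l)>-\infty$ for $l=-2,-1,1$, and that the top Lyapunov exponent $\gamma_A=\lim_{n\to\infty}\frac1n\mathbb E\log\|A_0A_1\cdots A_{n-1}\|$ is negative. For $n\ge1$ let $T_n=\inf\{t>0:X_t=n\}$, and for $i\in\mathbb Z$ let $\mathbf U_i^n=(U_{i,1}^n,U_{i,2}^n,U_{i,3}^n)$ be the numbers of steps before time $T_n$ from $i$ to $i-1$, from $i$ to $i-2$, and from $i+1$ to $i-1$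 respectively (jumps of type $1,2,3$ at level $i$). The sequence $\mathbf U^n_n=0,\mathbf U^n_{n-1},\mathbf U^n_{n-2},\dots$ is the 3-type branching process in random environment in the path: an individual of type $l$ at level $i+1$ is an excursion, which starts with a type-$l$ jump at level $i+1$ and ends when the walk next reaches $i+1$; its children are the jumps at level $i$ made during the excursion; and one individual of type $1$ immigrates at each of the levels $1,\dots,n$, and none at the levels $\le0$. Then for $\mathbb P$-almost every $\omega$ the following hold. 1. For every $i\in\mathbb Z$ the quenched mean offspring matrix from level $i+1$ to level $i$ is $A_i$: for $l,m\in\{1,2,3\}$, the $P_\omega$-mean number of type-$m$ children of a type-$l$ individual at level $i+1$ (that is, the mean number of type-$m$ jumps at level $i$ before the hitting time of $i+1$, for the walk started at the origin of a type-$l$ jump at level $i+1$ and conditioned to make this jump first) equals the $(l,m)$ entry of $A_i$. 2. For all $n\ge1$, $i\le n-1$ and $u\in\mathbb N^3$ with $P_\omega(\mathbf U_{i+1}^n=u)>0$, $$E_\omega(\mathbf U_i^n\mid\mathbf U_{i+1}^n=u)=\bigl(u+\mathbf 1_{\{i\ge0\}}\,\mathbf e_1\bigr)A_i .$$ In particular,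 for $i<0$, $E_\omega(\mathbf U_i^n\mid\mathbf U_{i+1}^n=\mathbf e_l)$ is the $l$-th row of $A_i$ whenever $P_\omega(\mathbf U_{i+1}^n=\mathbf e_l)>0$. 3. For all $n\ge1$, $$E_\omega T_n=n+\sum_{i=0}^{n-1}\sum_{k=-\infty}^{i}\mathbf e_1A_iA_{i-1}\cdots A_k(2,1,2)^t .$$ Here $\mathbf e_l$ is the $l$-th unit row vector. -/

import Mathlib

open MeasureTheory ProbabilityTheory
open scoped ENNReal Matrix

noncomputable section

namespace RWRE21

/-- The three possible displacements `-2`, `-1`, `1`, indexed by `0`, `1`, `2`. -/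
def jump : Fin 3 → ℤ := ![-2, -1, 1]

/-- A probability vector `(p(-2), p(-1), p(1))` on the displacements. -/
abbrev JumpLaw : Type := stdSimplex ℝ (Fin 3)

/-- An environment `ω = (ω_x)`, `x ∈ ℤ`. -/
abbrev Env : Type := ℤ → JumpLaw

/-- The law `ν^{⊗ℤ}` of an i.i.d. environment. -/
def envLaw (ν : Measure JumpLaw) : Measure Env := Measure.infinitePi (fun _ : ℤ => ν)

/-! ### The quenched walk -/

/-- The law of the next position of the walk when it is at `x`. -/
def stepMeasure (ω : Env) (x : ℤ) : Measure ℤ :=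
  ∑ j : Fin 3, ENNReal.ofReal ((ω x).1 j) • Measure.dirac (x + jump j)

instance (ω : Env) (x : ℤ) : IsProbabilityMeasure (stepMeasure ω x) := by
  constructor
  have h0 : ∀ j ∈ (Finset.univ : Finset (Fin 3)), 0 ≤ (ω x).1 j := fun j _ => (ω x).2.1 j
  have h1 : ∑ j : Fin 3, (ω x).1 j = 1 := (ω x).2.2
  simp only [stepMeasure, Measure.coe_finsetSum, Finset.sum_apply, Measure.smul_apply,
    measure_univ, smul_eq_mul, mul_one]
  rw [← ENNReal.ofReal_sum_of_nonneg h0, h1, ENNReal.ofReal_one]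

/-- The transition kernel on `ℤ` of the walk in the environment `ω`. -/
def stepKernel (ω : Env) : Kernel ℤ ℤ := Kernel.ofFunOfCountable (stepMeasure ω)

instance (ω : Env) : IsMarkovKernel (stepKernel ω) :=
  ⟨fun x => inferInstanceAs (IsProbabilityMeasure (stepMeasure ω x))⟩

/-- The transition kernel from the history up to time `t` to the position at time `t + 1`:
it depends on the history only through the position at time `t`. -/
def histKernel (ω : Env) (t : ℕ) : Kernel (Finset.Iic t → ℤ) ℤ :=
  (stepKernel ω).comap (fun h => h ⟨t, Finset.mem_Iic.2 le_rfl⟩) (measurable_pi_apply _)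

instance (ω : Env) (t : ℕ) : IsMarkovKernel (histKernel ω t) := by
  unfold histKernel; infer_instance

/-- The quenched law, on path space, of the Markov chain started at `x`
in the environment `ω`. -/
def quenched (ω : Env) (x : ℤ) : Measure (ℕ → ℤ) :=
  Kernel.trajMeasure (X := fun _ => ℤ) (Measure.dirac x) (histKernel ω)

/-! ### Hitting times and step counts of a path -/

/-- `T_n = inf {t > 0 : X_t = n}`, equal to `∞` if there is no such `t`. -/
def hit (n : ℤ) (X : ℕ → ℤ) : ℕ∞ := ⨅ (t : ℕ) (_ : 0 < t ∧ X t = n), (t : ℕ∞)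

/-- The number of steps from `x` to `y` strictly before `T_n`. -/
def stepCount (n x y : ℤ) (X : ℕ → ℤ) : ℕ∞ :=
  {k : ℕ | 0 < k ∧ (k : ℕ∞) < hit n X ∧ X (k - 1) = x ∧ X k = y}.encard

/-- The site from which a type-`l` jump at level `i` starts (types `1, 2, 3` are the indices
`0, 1, 2`): a jump of type 1, 2, 3 goes `i → i - 1`, `i → i - 2`, `i + 1 → i - 1`. -/
def jumpFrom (i : ℤ) : Fin 3 → ℤ := ![i, i, i + 1]

/-- The site at which a type-`l` jump at level `i` ends. -/
def jumpTo (i : ℤ) : Fin 3 → ℤ := ![i - 1, i - 2, i - 1]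

/-- The vector `U_i^n = (U_{i,1}^n, U_{i,2}^n, U_{i,3}^n)`. -/
def U (n i : ℤ) (X : ℕ → ℤ) : Fin 3 → ℕ∞ :=
  fun l => stepCount n (jumpFrom i l) (jumpTo i l) X

/-! ### The matrices `A_k` and the top Lyapunov exponent -/

/-- `a_k = ω_k(-1) / ω_k(1)`. -/
def a (ω : Env) (k : ℤ) : ℝ := (ω k).1 1 / (ω k).1 2

/-- `b_k = ω_k(-2) / ω_k(1)`. -/
def b (ω : Env) (k : ℤ) : ℝ := (ω k).1 0 / (ω k).1 2

/-- The matrix `A_k`. -/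
def A (ω : Env) (k : ℤ) : Matrix (Fin 3) (Fin 3) ℝ :=
  !![a ω k, b ω k, 0;
     a ω k, b ω k, 1;
     a ω k, b ω k, 0]

/-- `A_0 A_1 ⋯ A_{n-1}`. -/
def ascProd (ω : Env) (n : ℕ) : Matrix (Fin 3) (Fin 3) ℝ :=
  ((List.range n).map fun j => A ω (j : ℤ)).prod

/-- `A_i A_{i-1} ⋯ A_k`, for `k ≤ i`. -/
def descProd (ω : Env) (i k : ℤ) : Matrix (Fin 3) (Fin 3) ℝ :=
  ((List.range ((i - k).toNat + 1)).map fun j => A ω (i - (j : ℤ))).prod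

/-- The sum of the absolute values of the entries; any other matrix norm gives the same
Lyapunov exponent. -/
def entryNorm (M : Matrix (Fin 3) (Fin 3) ℝ) : ℝ := ∑ i, ∑ j, |M i j|

/-- The top Lyapunov exponent `γ_A = lim (1/n) E log ‖A_0 ⋯ A_{n-1}‖` of the i.i.d. sequence
`(A_k)`. The limit exists by subadditivity under the integrability condition `C1`; it is
written here as an upper limit in the extended reals. -/
def lyapunovA (ν : Measure JumpLaw) : EReal :=
  Filter.limsup
    (fun n : ℕ => (((∫ ω, Real.log (entryNorm (ascProd ω n)) ∂(envLaw ν)) / (n : ℝ) : ℝ) : EReal))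
    Filter.atTop

/-- `E log ω_0(l) > -∞` for `l = -2, -1, 1`. As `log 0` means `-∞` here, this comprises
`ω_0(l) > 0` almost surely. -/
def C1 (ν : Measure JumpLaw) : Prop :=
  ∀ l : Fin 3, (∀ᵐ p ∂ν, 0 < p.1 l) ∧ Integrable (fun p : JumpLaw => Real.log (p.1 l)) ν

/-- The top Lyapunov exponent is negative. -/
def C2 (ν : Measure JumpLaw) : Prop := lyapunovA ν < 0

/-! ### Mean offspring -/

/-- The quenched mean offspring matrix of the branching process in the path, from level `i + 1`
to level `i`. An individual of type `l` at level `i + 1` is an excursion: a type-`l` jump at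
level `i + 1`, followed by the walk until it reaches `i + 1` again. Its children are the
jumps at level `i` of the three types which occur in the excursion. So the `(l, m)` entry is
the mean number of type-`m` jumps at level `i` before the hitting time of `i + 1`, for the
walk started at the origin of a type-`l` jump at level `i + 1` and conditioned to make this
jump as its first step. -/
def meanOffspring (ω : Env) (i : ℤ) : Matrix (Fin 3) (Fin 3) ℝ≥0∞ :=
  Matrix.of fun l m =>
    ∫⁻ X, ((U (i + 1) i X m : ℕ∞) : ℝ≥0∞)
      ∂((quenched ω (jumpFrom (i + 1) l))[|{X : ℕ → ℤ | X 1 = jumpTo (i + 1) l}])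

/-- The immigrant at level `i + 1` (`i < n`), born into the next generation at level `i`:
one individual of type 1 if `i ≥ 0`, none if `i < 0`. -/
def immigrant (i : ℤ) : Fin 3 → ℝ := if 0 ≤ i then Pi.single 0 1 else 0

/-- The event `{U_i^n = u}`. -/
def levelEvent (n i : ℤ) (u : Fin 3 → ℕ) : Set (ℕ → ℤ) :=
  {X | ∀ l, U n i X l = (u l : ℕ∞)}

end RWRE21

end

noncomputable section

namespace RWRE21

/-! ### First-step decomposition of the quenched law -/

/-! Fix a good environment: all jump probabilities are positive and the products `A_i ⋯ A_k` come
arbitrarily close to zero as `k` decreases. Almost every environment is good (`ae_good`): a negative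
exponent gives one block length with negative mean log norm, and the strong law for disjoint blocks,
together with submultiplicativity, drives the products to zero.

If `g` is harmonic at `k`, its increments at levels `k + 1` and `k` are related by `A_k`. Hence a
bounded function harmonic on a left half-line is constant there (`eq_of_harmonic`). Two consequences
replace the strong Markov property. The walk a.s. hits every site to its right (`ae_exists_hit`),
and the law of the jump counts at level `i + 1` is the same from every starting point `≤ i + 1`
(`lintegral_total_eq`).

The core is `branching_identity`: the mean of the level-`i` counts, weighted by a bounded function
`φ` of the level-`(i + 1)` counts. A version truncated at time `t`, with a correction for the
excursion still running below `i + 1`, follows by first-step induction; the correction vanishes as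
`t → ∞`. Taking `φ = 1` after a prescribed first step gives the mean offspring, and `φ` the
indicator of a point gives the conditional means. Iterating the case `φ = 1` over levels gives all
mean counts, and the hitting time is `n` plus a weighted sum of counts. -/

/-- The path starting at `x` and continuing with `Y`. -/
def cons (x : ℤ) (Y : ℕ → ℤ) : ℕ → ℤ
  | 0 => x
  | t + 1 => Y t

/-- The path seen from time `1` on. -/
def tail (X : ℕ → ℤ) : ℕ → ℤ := fun t => X (t + 1)

@[simp] lemma cons_zero (x : ℤ) (Y : ℕ → ℤ) : cons x Y 0 = x := rfl

@[fun_prop] lemma measurable_cons (x : ℤ) : Measurable (cons x) := by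
  refine measurable_pi_iff.2 fun t => ?_
  cases t with
  | zero => exact measurable_const
  | succ t => exact measurable_pi_apply t

@[fun_prop] lemma measurable_tail : Measurable tail :=
  measurable_pi_iff.2 fun t => measurable_pi_apply (t + 1)

instance (ω : Env) (x : ℤ) : IsProbabilityMeasure (quenched ω x) := by
  unfold quenched; infer_instance

/-- The paths which agree with `z` up to time `t`. -/
def cyl (z : ℕ → ℤ) (t : ℕ) : Set (ℕ → ℤ) := {X | ∀ s ≤ t, X s = z s}

lemma cyl_eq_preimage (z : ℕ → ℤ) (t : ℕ) :
    cyl z t = Preorder.frestrictLe (π := fun _ => ℤ) t ⁻¹' {Preorder.frestrictLe t z} := by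
  ext X
  simp [cyl, funext_iff, Preorder.frestrictLe]

/-- Initial segments take countably many values, so their law is fixed by singletons, that is, by
cylinders. Every finite set of times lies in an initial segment, and finite-dimensional marginals
determine a finite measure on path space. -/
lemma ext_of_cyl {μ ν : Measure (ℕ → ℤ)} [IsFiniteMeasure μ]
    (h : ∀ z t, μ (cyl z t) = ν (cyl z t)) : μ = ν := by
  have key : ∀ t, μ.map (Preorder.frestrictLe (π := fun _ => ℤ) t)
      = ν.map (Preorder.frestrictLe t) := by
    intro t
    refine Measure.ext_of_singleton fun w => ?_
    rw [Measure.map_apply (by fun_prop) (measurableSet_singleton _),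
      Measure.map_apply (by fun_prop) (measurableSet_singleton _)]
    have : w = Preorder.frestrictLe (π := fun _ => ℤ) t
        (fun s => if hs : s ≤ t then w ⟨s, Finset.mem_Iic.2 hs⟩ else 0) := by
      funext s
      have := Finset.mem_Iic.1 s.2
      simp [Preorder.frestrictLe, this]
    rw [this, ← cyl_eq_preimage]
    exact h _ _
  have hall : ∀ I : Finset ℕ, μ.map I.restrict = ν.map I.restrict := by
    intro I
    rw [← Finset.restrict₂_comp_restrict (π := fun _ => ℤ) I.subset_Iic_sup_id,
      ← Measure.map_map (by fun_prop) (by fun_prop), ← Measure.map_map (by fun_prop) (by fun_prop)]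
    exact congrArg _ (key _)
  have hfin : ∀ I : Finset ℕ, IsFiniteMeasure (ν.map (I.restrict (π := fun _ => ℤ))) := fun I => by
    rw [← hall]; infer_instance
  exact IsProjectiveLimit.unique (P := fun I => ν.map I.restrict) hall (fun I => rfl)

lemma quenched_map_zero (ω : Env) (x : ℤ) :
    (quenched ω x).map (fun X => X 0) = Measure.dirac x := by
  have h : (quenched ω x).map (Preorder.frestrictLe (π := fun _ => ℤ) 0)
      = (Measure.dirac x).map (MeasurableEquiv.piUnique (fun _ : Finset.Iic 0 => ℤ)).symm := by
    rw [quenched, Kernel.trajMeasure, Measure.map_comp _ _ (by fun_prop),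
      Kernel.traj_map_frestrictLe, Kernel.partialTraj_self]
    exact Measure.id_comp
  have h2 : (fun X : ℕ → ℤ => X 0) =
      (fun w : (Finset.Iic 0 → ℤ) => w ⟨0, Finset.mem_Iic.2 le_rfl⟩) ∘
        Preorder.frestrictLe (π := fun _ => ℤ) 0 := rfl
  rw [h2, ← Measure.map_map (by fun_prop) (by fun_prop), h,
    Measure.map_map (by fun_prop) (by fun_prop), Measure.map_dirac' (by fun_prop)]
  rfl

lemma ae_start (ω : Env) (x : ℤ) : ∀ᵐ X ∂(quenched ω x), X 0 = x := by
  have h : ∀ᵐ y ∂((quenched ω x).map (fun X => X 0)), y = x := by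
    rw [quenched_map_zero, ae_dirac_eq]; rfl
  exact ae_of_ae_map (measurable_pi_apply 0).aemeasurable h

lemma quenched_cyl_succ (ω : Env) (x : ℤ) (z : ℕ → ℤ) (t : ℕ) :
    quenched ω x (cyl z (t + 1)) =
      quenched ω x (cyl z t) * stepMeasure ω (z t) {z (t + 1)} := by
  have h := Kernel.map_frestrictLe_trajMeasure_compProd_eq_map_trajMeasure
    (X := fun _ => ℤ) (μ₀ := Measure.dirac x) (κ := histKernel ω) (a := t)
  have h2 := congrArg (fun μ => μ ({Preorder.frestrictLe (π := fun _ => ℤ) t z} ×ˢ {z (t + 1)})) h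
  rw [Measure.compProd_apply_prod (measurableSet_singleton _) (measurableSet_singleton _),
    Measure.restrict_singleton, lintegral_smul_measure, lintegral_dirac,
    Measure.map_apply (by fun_prop) (measurableSet_singleton _),
    Measure.map_apply (by fun_prop) (by measurability), ← cyl_eq_preimage] at h2
  have hset : cyl z (t + 1) = (fun X : ℕ → ℤ => (Preorder.frestrictLe (π := fun _ => ℤ) t X,
      X (t + 1))) ⁻¹' ({Preorder.frestrictLe (π := fun _ => ℤ) t z} ×ˢ {z (t + 1)}) := by
    ext X
    have := Set.ext_iff.1 (cyl_eq_preimage z t) X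
    simp only [Set.mem_preimage, Set.mem_singleton_iff] at this
    simp only [Set.mem_preimage, Set.mem_prod, Set.mem_singleton_iff, ← this]
    simp only [cyl, Set.mem_ofPred_eq]
    constructor
    · exact fun H => ⟨fun s hs => H s (by omega), H _ le_rfl⟩
    · rintro ⟨H1, H2⟩ s hs
      rcases Nat.lt_or_ge t s with hst | hst
      · obtain rfl : s = t + 1 := by omega
        exact H2
      · exact H1 s hst
  rw [hset]
  exact h2.symm

lemma quenched_cyl (ω : Env) (x : ℤ) (z : ℕ → ℤ) (t : ℕ) :
    quenched ω x (cyl z t) =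
      if z 0 = x then ∏ s ∈ Finset.range t, stepMeasure ω (z s) {z (s + 1)} else 0 := by
  induction t with
  | zero =>
    have : cyl z 0 = (fun X : ℕ → ℤ => X 0) ⁻¹' {z 0} := by ext X; simp [cyl]
    rw [this, ← Measure.map_apply (by fun_prop) (measurableSet_singleton _), quenched_map_zero]
    simp [Set.indicator_apply, eq_comm]
  | succ t ih =>
    rw [quenched_cyl_succ, ih, Finset.prod_range_succ]
    split_ifs <;> simp

/-- Both sides give each cylinder the same product of transition probabilities. This is the Markov
property at time 1, the only form of it that the later arguments use. -/
theorem quenched_eq_sum (ω : Env) (x : ℤ) :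
    quenched ω x = ∑ j : Fin 3, ENNReal.ofReal ((ω x).1 j) •
      (quenched ω (x + jump j)).map (cons x) := by
  refine ext_of_cyl fun z t => ?_
  have hcyl : ∀ t, MeasurableSet (cyl z t) := fun t => by
    rw [cyl_eq_preimage]; exact measurableSet_preimage (by fun_prop) (measurableSet_singleton _)
  simp only [Measure.coe_finsetSum, Finset.sum_apply, Measure.smul_apply, smul_eq_mul,
    Measure.map_apply (measurable_cons x) (hcyl t)]
  by_cases hz : z 0 = x
  · cases t with
    | zero =>
      have : cons x ⁻¹' cyl z 0 = Set.univ := by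
        ext X; simp [cyl, hz]
      have h1 := measure_univ (μ := stepMeasure ω x)
      rw [stepMeasure] at h1
      simp only [this, measure_univ, mul_one, quenched_cyl, hz]
      simpa using h1.symm
    | succ t =>
      have : cons x ⁻¹' cyl z (t + 1) = cyl (fun s => z (s + 1)) t := by
        ext X
        simp only [cyl, Set.mem_preimage, Set.mem_ofPred_eq]
        constructor
        · intro H s hs
          exact H (s + 1) (by omega)
        · intro H s hs
          cases s with
          | zero => exact hz.symm
          | succ s => exact H s (by omega)
      rw [this]
      simp only [quenched_cyl, hz, if_true, zero_add]
      rw [Finset.prod_range_succ', hz, mul_comm, stepMeasure]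
      simp only [zero_add, Measure.coe_finsetSum, Finset.sum_apply, Measure.smul_apply, smul_eq_mul,
        Finset.sum_mul]
      refine Finset.sum_congr rfl fun j _ => ?_
      by_cases hj : z 1 = x + jump j
      · simp [hj]
      · simp [hj, Ne.symm hj]
  · have : cons x ⁻¹' cyl z t = ∅ := by
      ext X
      simp only [cyl, Set.mem_preimage, Set.mem_ofPred_eq, Set.mem_empty_iff_false, iff_false]
      exact fun H => hz (H 0 (Nat.zero_le _)).symm
    simp [quenched_cyl, hz, this]

theorem lintegral_quenched (ω : Env) (x : ℤ) {F : (ℕ → ℤ) → ℝ≥0∞} (hF : Measurable F) :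
    ∫⁻ X, F X ∂(quenched ω x) = ∑ j : Fin 3, ENNReal.ofReal ((ω x).1 j) *
      ∫⁻ Y, F (cons x Y) ∂(quenched ω (x + jump j)) := by
  rw [quenched_eq_sum, lintegral_finsetSum_measure]
  refine Finset.sum_congr rfl fun j _ => ?_
  rw [lintegral_smul_measure, lintegral_map hF (measurable_cons x), smul_eq_mul]

/-- First-step decomposition for functionals of the first two positions and the tail. -/
theorem lintegral_quenched_tail (ω : Env) (x : ℤ) {F : (ℕ → ℤ) → ℝ≥0∞} (hF : Measurable F)
    (G : Fin 3 → (ℕ → ℤ) → ℝ≥0∞)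
    (h : ∀ j X, X 0 = x → X 1 = x + jump j → F X = G j (tail X)) :
    ∫⁻ X, F X ∂(quenched ω x) = ∑ j : Fin 3, ENNReal.ofReal ((ω x).1 j) *
      ∫⁻ Y, G j Y ∂(quenched ω (x + jump j)) := by
  rw [lintegral_quenched ω x hF]
  refine Finset.sum_congr rfl fun j _ => ?_
  congr 1
  refine lintegral_congr_ae ?_
  filter_upwards [ae_start ω (x + jump j)] with Y hY
  exact h j (cons x Y) rfl hY

lemma sum_ofReal_env (ω : Env) (x : ℤ) : ∑ j : Fin 3, ENNReal.ofReal ((ω x).1 j) = 1 := by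
  rw [← ENNReal.ofReal_sum_of_nonneg fun j _ => (ω x).2.1 j, (ω x).2.2, ENNReal.ofReal_one]

/-! ### Entry norm and products of the matrices -/

lemma entryNorm_nonneg (M : Matrix (Fin 3) (Fin 3) ℝ) : 0 ≤ entryNorm M :=
  Finset.sum_nonneg fun _ _ => Finset.sum_nonneg fun _ _ => abs_nonneg _

lemma abs_le_entryNorm (M : Matrix (Fin 3) (Fin 3) ℝ) (i j : Fin 3) : |M i j| ≤ entryNorm M :=
  (Finset.single_le_sum (f := fun j => |M i j|) (fun _ _ => abs_nonneg _)
    (Finset.mem_univ j)).trans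
    (Finset.single_le_sum (f := fun i => ∑ j, |M i j|)
      (fun _ _ => Finset.sum_nonneg fun _ _ => abs_nonneg _) (Finset.mem_univ i))

lemma entryNorm_mul_le (M N : Matrix (Fin 3) (Fin 3) ℝ) :
    entryNorm (M * N) ≤ entryNorm M * entryNorm N := by
  have h1 : ∀ i k, |(M * N) i k| ≤ ∑ j, |M i j| * |N j k| := fun i k => by
    rw [Matrix.mul_apply]
    exact (Finset.abs_sum_le_sum_abs _ _).trans_eq (Finset.sum_congr rfl fun j _ => abs_mul _ _)
  have h2 : ∀ j, ∑ k, |N j k| ≤ entryNorm N := fun j =>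
    Finset.single_le_sum (f := fun i => ∑ j, |N i j|)
      (fun _ _ => Finset.sum_nonneg fun _ _ => abs_nonneg _) (Finset.mem_univ j)
  calc entryNorm (M * N) ≤ ∑ i, ∑ k, ∑ j, |M i j| * |N j k| :=
        Finset.sum_le_sum fun i _ => Finset.sum_le_sum fun k _ => h1 i k
    _ = ∑ i, ∑ j, |M i j| * ∑ k, |N j k| := by
        refine Finset.sum_congr rfl fun i _ => ?_
        rw [Finset.sum_comm]
        simp only [Finset.mul_sum]
    _ ≤ ∑ i, ∑ j, |M i j| * entryNorm N :=
        Finset.sum_le_sum fun i _ => Finset.sum_le_sum fun j _ =>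
          mul_le_mul_of_nonneg_left (h2 j) (abs_nonneg _)
    _ = entryNorm M * entryNorm N := by
        simp only [entryNorm, Finset.sum_mul]

lemma descProd_eq (ω : Env) (i k : ℤ) :
    descProd ω i k = ((List.range ((i - k).toNat + 1)).map fun j : ℕ => A ω (i - j)).prod := by
  simp [descProd, ← List.map_eq_flatMap, Function.comp_def]

lemma ascProd_eq (ω : Env) (n : ℕ) :
    ascProd ω n = ((List.range n).map fun j : ℕ => A ω j).prod := by
  simp [ascProd, ← List.map_eq_flatMap, Function.comp_def]

lemma descProd_self (ω : Env) (i : ℤ) : descProd ω i i = A ω i := by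
  simp [descProd]

lemma descProd_sub_succ (ω : Env) (i : ℤ) (M : ℕ) :
    descProd ω i (i - (M + 1 : ℕ)) = descProd ω i (i - M) * A ω (i - (M + 1 : ℕ)) := by
  have h1 : (i - (i - ((M + 1 : ℕ) : ℤ))).toNat = M + 1 := by omega
  have h2 : (i - (i - (M : ℤ))).toNat = M := by omega
  rw [descProd_eq, descProd_eq, h1, h2, List.range_succ (n := M + 1), List.map_append,
    List.prod_append]
  simp

lemma descProd_of_lt (ω : Env) {i k : ℤ} (h : k < i) :
    descProd ω i k = descProd ω i (k + 1) * A ω k := by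
  obtain ⟨M, rfl⟩ : ∃ M : ℕ, k = i - (M + 1 : ℕ) := ⟨(i - k - 1).toNat, by omega⟩
  rw [descProd_sub_succ]
  congr 2
  push_cast; ring

/-! ### Bounded functions that are harmonic on a left half-line -/

/-- All jump probabilities are positive, and the products `A_i A_{i-1} ⋯ A_k` come arbitrarily
close to zero. -/
structure Good (ω : Env) : Prop where
  pos : ∀ x j, 0 < (ω x).1 j
  small : ∀ (i : ℤ) (ε : ℝ), 0 < ε → ∃ M : ℕ, entryNorm (descProd ω i (i - M)) < ε

/-- The vector of increments of `g` over the jumps of the three types at level `k`. -/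
def incr (g : ℤ → ℝ) (k : ℤ) : Fin 3 → ℝ :=
  ![g (k - 1) - g k, g (k - 2) - g k, g (k - 1) - g k]

/-- Harmonicity at `k` divided by `ω_k(1)` expresses `g k - g (k + 1)` through `a_k`, `b_k` and the
increments at `k`; this is rows one and three. The second row adds `g (k - 1) - g k`, which the
entry 1 picks up from the third component. -/
lemma incr_succ {ω : Env} (hω : Good ω) {g : ℤ → ℝ} {k : ℤ}
    (hg : g k = ∑ j, (ω k).1 j * g (k + jump j)) : incr g (k + 1) = A ω k *ᵥ incr g k := by
  have hp := hω.pos k 2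
  have hs : (ω k).1 0 + (ω k).1 1 + (ω k).1 2 = 1 := by
    have := (ω k).2.2
    rwa [Fin.sum_univ_three] at this
  simp only [Fin.sum_univ_three, jump, Matrix.cons_val_zero, Matrix.cons_val_one,
    Matrix.cons_val] at hg
  have e1 : k + 1 - 1 = k := by ring
  have e2 : k + 1 - 2 = k - 1 := by ring
  have e3 : k + -2 = k - 2 := by ring
  have e4 : k + -1 = k - 1 := by ring
  rw [e3, e4] at hg
  have key : a ω k * (g (k - 1) - g k) + b ω k * (g (k - 2) - g k) = g k - g (k + 1) := by
    rw [a, b]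
    field_simp
    linear_combination (-1 : ℝ) * hg - g k * hs
  funext l
  fin_cases l <;>
    simp [incr, A, Matrix.mulVec, dotProduct, Fin.sum_univ_three, e1, e2] <;> linarith [key]

lemma incr_eq_descProd_mulVec {ω : Env} (hω : Good ω) {g : ℤ → ℝ} {i : ℤ}
    (hg : ∀ x ≤ i, g x = ∑ j, (ω x).1 j * g (x + jump j)) (M : ℕ) :
    incr g (i + 1) = descProd ω i (i - M) *ᵥ incr g (i - M) := by
  induction M with
  | zero => simpa [descProd_self] using incr_succ hω (hg i le_rfl)
  | succ M ih =>
    rw [ih, descProd_sub_succ, ← Matrix.mulVec_mulVec,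
      ← incr_succ hω (hg (i - (M + 1 : ℕ)) (by omega))]
    congr 2
    push_cast; ring

/-- Liouville property: a bounded function which is harmonic on `(-∞, i]` is constant on
`(-∞, i + 1]`. -/
theorem eq_of_harmonic {ω : Env} (hω : Good ω) {g : ℤ → ℝ} {i : ℤ} {C : ℝ}
    (hC : ∀ x, |g x| ≤ C) (hg : ∀ x ≤ i, g x = ∑ j, (ω x).1 j * g (x + jump j))
    {x : ℤ} (hx : x ≤ i + 1) : g x = g (i + 1) := by
  have hC0 : 0 ≤ C := (abs_nonneg _).trans (hC 0)
  have step : ∀ y ≤ i, g y = g (y + 1) := by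
    intro y hy
    by_contra hne
    have hpos : 0 < |g y - g (y + 1)| := abs_pos.2 (sub_ne_zero.2 hne)
    -- `6 * C` is three summands, each with an increment bounded by `2 * C`; the added 1 keeps the
    -- denominator positive when `C = 0`.
    obtain ⟨M, hM⟩ := hω.small y (|g y - g (y + 1)| / (6 * C + 1)) (by positivity)
    have h := congrFun (incr_eq_descProd_mulVec hω (fun x hx => hg x (hx.trans hy)) M) 0
    have hb : ∀ l, |incr g (y - M) l| ≤ 2 * C := by
      intro l
      have hd : ∀ u v, |g u - g v| ≤ 2 * C := fun u v => by
        have := abs_sub (g u) (g v)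
        linarith [hC u, hC v]
      fin_cases l <;> exact hd _ _
    have h3 : |g y - g (y + 1)| ≤ entryNorm (descProd ω y (y - M)) * (6 * C) := by
      have : incr g (y + 1) 0 = g y - g (y + 1) := by simp [incr]
      rw [← this, h, Matrix.mulVec, dotProduct]
      calc |∑ l, descProd ω y (y - M) 0 l * incr g (y - M) l|
          ≤ ∑ l : Fin 3, entryNorm (descProd ω y (y - M)) * (2 * C) := by
            refine (Finset.abs_sum_le_sum_abs _ _).trans (Finset.sum_le_sum fun l _ => ?_)
            rw [abs_mul]
            exact mul_le_mul (abs_le_entryNorm _ _ _) (hb l) (abs_nonneg _) (entryNorm_nonneg _)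
        _ = _ := by simp; ring
    have h4 := (lt_div_iff₀ (by positivity : 0 < 6 * C + 1)).1 hM
    nlinarith [entryNorm_nonneg (descProd ω y (y - M))]
  obtain ⟨m, rfl⟩ : ∃ m : ℕ, x = i + 1 - m := ⟨(i + 1 - x).toNat, by omega⟩
  induction m with
  | zero => simp
  | succ m ih =>
    rw [step _ (by push_cast; omega), ← ih (by omega)]
    congr 1
    push_cast; ring

/-! ### Almost every environment is good -/

/-- The product `A_c A_{c-1} ⋯ A_{c-n+1}` of `n` matrices. -/
def downProd (ω : Env) (c : ℤ) (n : ℕ) : Matrix (Fin 3) (Fin 3) ℝ :=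
  ((List.range n).map fun j : ℕ => A ω (c - j)).prod

/-- The environment seen from `c` in the reversed direction. -/
def reverse (c : ℤ) (ω : Env) : Env := fun k => ω (c - k)

/-- The exponent is defined by ascending products while the walk needs descending ones; reversing
the environment exchanges them and preserves its i.i.d. law. -/
lemma ascProd_reverse (c : ℤ) (ω : Env) (n : ℕ) :
    ascProd (reverse c ω) n = downProd ω c n := ascProd_eq _ _

lemma downProd_add (ω : Env) (c : ℤ) (m n : ℕ) :
    downProd ω c (m + n) = downProd ω c m * downProd ω (c - m) n := by
  simp only [downProd, List.range_add, List.map_append, List.prod_append, List.map_map]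
  congr 3
  funext j
  simp [sub_sub]

lemma descProd_eq_downProd (ω : Env) (i : ℤ) (M : ℕ) :
    descProd ω i (i - M) = downProd ω i (M + 1) := by
  rw [descProd_eq, downProd]
  congr 4
  omega

lemma A_nonneg (ω : Env) (k : ℤ) (l m : Fin 3) : 0 ≤ A ω k l m := by
  have ha : 0 ≤ a ω k := div_nonneg ((ω k).2.1 _) ((ω k).2.1 _)
  have hb : 0 ≤ b ω k := div_nonneg ((ω k).2.1 _) ((ω k).2.1 _)
  fin_cases l <;> fin_cases m <;> simp [A, ha, hb]

lemma downProd_nonneg (ω : Env) (c : ℤ) (n : ℕ) (l m : Fin 3) : 0 ≤ downProd ω c n l m := by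
  induction n generalizing l m with
  | zero => simp [downProd, Matrix.one_apply]; split_ifs <;> norm_num
  | succ n ih =>
    rw [downProd_add, Matrix.mul_apply]
    refine Finset.sum_nonneg fun j _ => mul_nonneg (ih _ _) ?_
    simpa [downProd] using A_nonneg ω _ j m

lemma entryNorm_downProd_pos {ω : Env} (hω : ∀ x j, 0 < (ω x).1 j) (c : ℤ) (n : ℕ) :
    0 < entryNorm (downProd ω c n) := by
  suffices h : 0 < downProd ω c n 0 0 from
    (h.trans_le (le_abs_self _)).trans_le (abs_le_entryNorm _ _ _)
  induction n with
  | zero => simp [downProd]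
  | succ n ih =>
    rw [downProd_add, Matrix.mul_apply]
    refine lt_of_lt_of_le (mul_pos ih ?_) (Finset.single_le_sum
      (f := fun j => downProd ω c n 0 j * downProd ω (c - n) 1 j 0) (fun j _ =>
      mul_nonneg (downProd_nonneg _ _ _ _ _) (downProd_nonneg _ _ _ _ _)) (Finset.mem_univ 0))
    simpa [downProd, A, a] using div_pos (hω _ _) (hω _ _)

lemma measurable_env_apply (k : ℤ) (j : Fin 3) : Measurable fun ω : Env => (ω k).1 j :=
  (measurable_pi_apply j).comp (measurable_subtype_coe.comp (measurable_pi_apply k))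

lemma measurable_A (k : ℤ) (l m : Fin 3) : Measurable fun ω : Env => A ω k l m := by
  have ha : Measurable fun ω : Env => a ω k :=
    (measurable_env_apply k 1).div (measurable_env_apply k 2)
  have hb : Measurable fun ω : Env => b ω k :=
    (measurable_env_apply k 0).div (measurable_env_apply k 2)
  fin_cases l <;> fin_cases m <;> simp [A, ha, hb]

lemma measurable_ascProd (n : ℕ) (l m : Fin 3) : Measurable fun ω : Env => ascProd ω n l m := by
  induction n generalizing l m with
  | zero => simp [ascProd_eq]
  | succ n ih =>
    simp only [ascProd_eq, List.range_succ, List.map_append, List.prod_append, List.map_cons,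
      List.map_nil, List.prod_singleton, Matrix.mul_apply] at ih ⊢
    exact Finset.measurable_sum _ fun j _ => (ih l j).mul (measurable_A _ _ _)

lemma measurable_log_entryNorm (n : ℕ) :
    Measurable fun ω : Env => Real.log (entryNorm (ascProd ω n)) := by
  refine Real.measurable_log.comp ?_
  exact Finset.measurable_sum _ fun l _ => Finset.measurable_sum _ fun m _ =>
    continuous_abs.measurable.comp (measurable_ascProd n l m)

lemma measurePreserving_reverse (ν : Measure JumpLaw) [IsProbabilityMeasure ν] (c : ℤ) :
    MeasurePreserving (reverse c) (envLaw ν) (envLaw ν) := by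
  refine ⟨measurable_pi_iff.2 fun k => measurable_pi_apply _, ?_⟩
  exact Measure.map_infinitePi_infinitePi_of_inj (P := fun _ : ℤ => ν)
    (f := fun k : ℤ => c - k) sub_right_injective

instance (ν : Measure JumpLaw) [IsProbabilityMeasure ν] : IsProbabilityMeasure (envLaw ν) := by
  unfold envLaw; infer_instance

/-- Functions of the environment on disjoint blocks are independent. -/
lemma indepFun_of_disjoint (ν : Measure JumpLaw) [IsProbabilityMeasure ν] {S T : Finset ℤ}
    (hST : Disjoint S T) {f g : Env → ℝ} (hf : Measurable f) (hg : Measurable g)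
    (hfS : ∀ ω ω' : Env, (∀ k ∈ S, ω k = ω' k) → f ω = f ω')
    (hgT : ∀ ω ω' : Env, (∀ k ∈ T, ω k = ω' k) → g ω = g ω') :
    IndepFun f g (envLaw ν) := by
  classical
  obtain ⟨p⟩ : Nonempty JumpLaw := by
    by_contra h
    rw [not_nonempty_iff] at h
    simpa [Measure.eq_zero_of_isEmpty ν] using measure_univ (μ := ν)
  -- Outside the block the environment is filled with a fixed law `p`; a function of the block does
  -- not see this choice.
  let ext (S : Finset ℤ) (w : S → JumpLaw) : Env := fun k => if h : k ∈ S then w ⟨k, h⟩ else p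
  have hext : ∀ S, Measurable (ext S) := fun S => measurable_pi_iff.2 fun k => by
    by_cases h : k ∈ S
    · simpa [ext, h] using measurable_pi_apply (X := fun _ : S => JumpLaw) ⟨k, h⟩
    · simp [ext, h]
  have hi : iIndepFun (fun (k : ℤ) (ω : Env) => ω k) (envLaw ν) :=
    iIndepFun_infinitePi (P := fun _ : ℤ => ν) (X := fun _ x => x) fun _ => measurable_id
  have h := (hi.indepFun_finset S T hST fun k => measurable_pi_apply k).comp
    (hf.comp (hext S)) (hg.comp (hext T))
  have e1 : (f ∘ ext S) ∘ (fun (ω : Env) (k : S) => ω k) = f := by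
    funext ω
    exact hfS _ _ fun k hk => by simp [ext, hk]
  have e2 : (g ∘ ext T) ∘ (fun (ω : Env) (k : T) => ω k) = g := by
    funext ω
    exact hgT _ _ fun k hk => by simp [ext, hk]
  rwa [e1, e2] at h

lemma ascProd_reverse_congr {c : ℤ} {n : ℕ} {ω ω' : Env}
    (h : ∀ k ∈ Finset.Ioc (c - n) c, ω k = ω' k) :
    ascProd (reverse c ω) n = ascProd (reverse c ω') n := by
  rw [ascProd_reverse, ascProd_reverse, downProd, downProd]
  congr 1
  refine List.map_congr_left fun j hj => ?_
  rw [List.mem_range] at hj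
  simp only [A, a, b, h (c - j) (Finset.mem_Ioc.2 ⟨by omega, by omega⟩)]

/-- The strong law of large numbers for the norms of successive blocks of matrices. -/
lemma ae_tendsto_block_average (ν : Measure JumpLaw) [IsProbabilityMeasure ν] (N : ℕ)
    (hint : Integrable (fun ω => Real.log (entryNorm (ascProd ω N))) (envLaw ν)) (i : ℤ) :
    ∀ᵐ ω ∂(envLaw ν), Filter.Tendsto (fun m : ℕ => (∑ j ∈ Finset.range m,
      Real.log (entryNorm (downProd ω (i - (j * N : ℕ)) N))) / m) Filter.atTop
      (nhds (∫ ω, Real.log (entryNorm (ascProd ω N)) ∂(envLaw ν))) := by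
  set f : Env → ℝ := fun ω => Real.log (entryNorm (ascProd ω N)) with hf
  have hfm : Measurable f := measurable_log_entryNorm N
  have hmp := fun c => measurePreserving_reverse ν c
  let Y : ℕ → Env → ℝ := fun j => f ∘ reverse (i - (j * N : ℕ))
  have hlaw : ∀ j, (envLaw ν).map (Y j) = (envLaw ν).map f := fun j => by
    rw [← Measure.map_map hfm (hmp _).measurable, (hmp _).map_eq]
  have hmeas : ∀ j, Measurable (Y j) := fun j => hfm.comp (hmp _).measurable
  have h := strong_law_ae_real Y ((hmp _).integrable_comp_of_integrable hint) ?_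
    (fun j => ⟨(hmeas j).aemeasurable, (hmeas 0).aemeasurable, by rw [hlaw, hlaw]⟩)
  · have hI : ∫ ω, Y 0 ω ∂(envLaw ν) = ∫ ω, f ω ∂(envLaw ν) := by
      have := integral_map (μ := envLaw ν) (hmp (i - (0 * N : ℕ))).measurable.aemeasurable
        (f := f) hfm.aestronglyMeasurable
      rw [(hmp _).map_eq] at this
      exact this.symm
    rw [hI] at h
    filter_upwards [h] with ω hω
    simpa only [Y, f, Function.comp_apply, ascProd_reverse] using hω
  · intro j j' hjj'
    refine indepFun_of_disjoint ν
      (S := Finset.Ioc (i - (j * N : ℕ) - N) (i - (j * N : ℕ)))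
      (T := Finset.Ioc (i - (j' * N : ℕ) - N) (i - (j' * N : ℕ))) ?_ (hmeas j) (hmeas j') ?_ ?_
    · rw [Finset.disjoint_left]
      intro k hk hk'
      rw [Finset.mem_Ioc] at hk hk'
      rcases lt_or_gt_of_ne hjj' with h | h
      · have := Nat.mul_le_mul_right N (Nat.succ_le_of_lt h)
        rw [Nat.succ_mul] at this
        omega
      · have := Nat.mul_le_mul_right N (Nat.succ_le_of_lt h)
        rw [Nat.succ_mul] at this
        omega
    · intro ω ω' h
      simp only [Y, f, Function.comp_apply, ascProd_reverse_congr h]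
    · intro ω ω' h
      simp only [Y, f, Function.comp_apply, ascProd_reverse_congr h]

/-- A negative upper limit already gives one negative term. A single block length suffices, so the
subadditive ergodic theorem is not needed. -/
lemma exists_integral_neg {ν : Measure JumpLaw} (hC2 : C2 ν) :
    ∃ N : ℕ, 1 ≤ N ∧ ∫ ω, Real.log (entryNorm (ascProd ω N)) ∂(envLaw ν) < 0 := by
  have h := (Filter.eventually_lt_of_limsup_lt hC2).and (Filter.eventually_ge_atTop 1)
  obtain ⟨N, hN, hN1⟩ := h.exists
  refine ⟨N, hN1, ?_⟩
  have hN' : (∫ ω, Real.log (entryNorm (ascProd ω N)) ∂(envLaw ν)) / (N : ℝ) < 0 := by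
    exact_mod_cast hN
  by_contra hcon
  exact absurd hN' (not_lt.2 (div_nonneg (not_lt.1 hcon) (Nat.cast_nonneg _)))

theorem ae_good (ν : Measure JumpLaw) [IsProbabilityMeasure ν] (hC1 : C1 ν) (hC2 : C2 ν) :
    ∀ᵐ ω ∂(envLaw ν), Good ω := by
  obtain ⟨N, hN1, hN⟩ := exists_integral_neg hC2
  -- Integrability is automatic: the integral of a non-integrable function is 0 by convention,
  -- whereas this one is negative.
  have hint : Integrable (fun ω => Real.log (entryNorm (ascProd ω N))) (envLaw ν) := by
    by_contra h
    rw [integral_undef h] at hN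
    exact lt_irrefl _ hN
  have hpos : ∀ᵐ ω ∂(envLaw ν), ∀ x j, 0 < (ω x).1 j := by
    refine ae_all_iff.2 fun x => ae_all_iff.2 fun j => ?_
    exact (measurePreserving_eval_infinitePi (fun _ : ℤ => ν) x).quasiMeasurePreserving.ae
      (hC1 j).1
  filter_upwards [hpos, ae_all_iff.2 (ae_tendsto_block_average ν N hint)] with ω hω hlim
  refine ⟨hω, fun i ε hε => ?_⟩
  set Y : ℕ → ℝ := fun j => Real.log (entryNorm (downProd ω (i - (j * N : ℕ)) N)) with hY
  -- The constant 3 is the entry norm of the identity, the empty product at `m = 0`.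
  have hbound : ∀ m : ℕ, entryNorm (downProd ω i (m * N)) ≤
      3 * Real.exp (∑ j ∈ Finset.range m, Y j) := by
    intro m
    induction m with
    | zero => simp [downProd, entryNorm, Fin.sum_univ_three, Matrix.one_apply]; norm_num
    | succ m ih =>
      rw [Nat.succ_mul, downProd_add, Finset.sum_range_succ, Real.exp_add, ← mul_assoc]
      refine (entryNorm_mul_le _ _).trans (mul_le_mul ih ?_ (entryNorm_nonneg _) (by positivity))
      rw [hY, Real.exp_log (entryNorm_downProd_pos hω _ _)]
  have hsum : Filter.Tendsto (fun m : ℕ => ∑ j ∈ Finset.range m, Y j) Filter.atTop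
      Filter.atBot := by
    refine (tendsto_natCast_atTop_atTop.atTop_mul_neg hN (hlim i)).congr' ?_
    filter_upwards [Filter.eventually_ge_atTop 1] with m hm
    have : (m : ℝ) ≠ 0 := by positivity
    field_simp
    rfl
  have hexp : Filter.Tendsto (fun m : ℕ => 3 * Real.exp (∑ j ∈ Finset.range m, Y j)) Filter.atTop
      (nhds 0) := by
    simpa using (Real.tendsto_exp_atBot.comp hsum).const_mul 3
  obtain ⟨m, hm, hm1⟩ := ((hexp.eventually_lt_const hε).and
    (Filter.eventually_ge_atTop 1)).exists
  -- `descProd ω i (i - M)` has `M + 1` factors, hence the shift by one.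
  refine ⟨m * N - 1, ?_⟩
  have : 1 ≤ m * N := Nat.mul_pos hm1 hN1
  rw [descProd_eq_downProd, Nat.sub_add_cancel this]
  exact (hbound m).trans_lt hm

/-! ### Truncated step counts -/

/-- The path does not visit `n` up to time `t`. -/
def Avoids (n : ℤ) (t : ℕ) (X : ℕ → ℤ) : Prop := ∀ s ≤ t, X s ≠ n

lemma avoids_zero {n : ℤ} {X : ℕ → ℤ} : Avoids n 0 X ↔ X 0 ≠ n := by simp [Avoids]

lemma avoids_succ {n : ℤ} {t : ℕ} {X : ℕ → ℤ} :
    Avoids n (t + 1) X ↔ X 0 ≠ n ∧ Avoids n t (tail X) := by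
  constructor
  · exact fun h => ⟨h 0 (Nat.zero_le _), fun s hs => h (s + 1) (by omega)⟩
  · rintro ⟨h0, h⟩ s hs
    cases s with
    | zero => exact h0
    | succ s => exact h s (by omega)

lemma measurableSet_avoids (n : ℤ) (t : ℕ) : MeasurableSet {X | Avoids n t X} := by
  have : {X | Avoids n t X} = ⋂ s, ⋂ (_ : s ≤ t), (fun X : ℕ → ℤ => X s) ⁻¹' {n}ᶜ := by
    ext X; simp [Avoids]
  rw [this]
  exact MeasurableSet.iInter fun s => MeasurableSet.iInter fun _ =>
    measurableSet_preimage (measurable_pi_apply s) (measurableSet_singleton n).compl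

/-- The indicator of a jump of type `l` at level `k`, for a step from `x` to `y`. -/
def mark (k : ℤ) (l : Fin 3) (x y : ℤ) : ℝ≥0∞ :=
  if x = jumpFrom k l ∧ y = jumpTo k l then 1 else 0

open Classical in
/-- The indicator that the step at time `s` is of type `l` at level `k` and that `n` was not
visited up to time `s`. -/
def markAt (n k : ℤ) (l : Fin 3) (s : ℕ) (X : ℕ → ℤ) : ℝ≥0∞ :=
  if Avoids n s X then mark k l (X s) (X (s + 1)) else 0

/-- The number of jumps of type `l` at level `k` among the first `t` steps, before the first
visit of `n`. -/
def count (n k : ℤ) (l : Fin 3) (t : ℕ) (X : ℕ → ℤ) : ℝ≥0∞ :=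
  ∑ s ∈ Finset.range t, markAt n k l s X

/-- The number of jumps of type `l` at level `k` before the first visit of `n`. -/
def total (n k : ℤ) (X : ℕ → ℤ) (l : Fin 3) : ℝ≥0∞ := ∑' s, markAt n k l s X

open Classical in
/-- The indicator that at time `t` the path is at or below `i` and has not yet visited `n`. -/
def below (n i : ℤ) (t : ℕ) (X : ℕ → ℤ) : ℝ≥0∞ :=
  if Avoids n t X ∧ X t ≤ i then 1 else 0

@[fun_prop] lemma measurable_markAt (n k : ℤ) (l : Fin 3) (s : ℕ) :
    Measurable (markAt n k l s) := by
  classical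
  have h : Measurable fun X : ℕ → ℤ => mark k l (X s) (X (s + 1)) := by
    have : Measurable fun p : ℤ × ℤ => mark k l p.1 p.2 := measurable_of_countable _
    exact this.comp (f := fun X : ℕ → ℤ => (X s, X (s + 1)))
      ((measurable_pi_apply s).prodMk (measurable_pi_apply (s + 1)))
  exact Measurable.ite (measurableSet_avoids n s) h measurable_const

@[fun_prop] lemma measurable_count (n k : ℤ) (l : Fin 3) (t : ℕ) : Measurable (count n k l t) :=
  Finset.measurable_sum _ fun s _ => measurable_markAt n k l s

@[fun_prop] lemma measurable_total_apply (n k : ℤ) (l : Fin 3) :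
    Measurable fun X => total n k X l :=
  Measurable.tsum fun s => measurable_markAt n k l s

@[fun_prop] lemma measurable_total (n k : ℤ) : Measurable (total n k) :=
  measurable_pi_iff.2 fun l => measurable_total_apply n k l

@[fun_prop] lemma measurable_below (n i : ℤ) (t : ℕ) : Measurable (below n i t) := by
  classical
  refine Measurable.ite ((measurableSet_avoids n t).inter ?_) measurable_const measurable_const
  exact measurableSet_preimage (f := fun X : ℕ → ℤ => X t) (measurable_pi_apply t)
    (measurableSet_Iic (a := i))

lemma markAt_zero {n : ℤ} {X : ℕ → ℤ} (h : X 0 ≠ n) (k : ℤ) (l : Fin 3) :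
    markAt n k l 0 X = mark k l (X 0) (X 1) := by
  simp [markAt, avoids_zero, h]

lemma markAt_succ {n : ℤ} {X : ℕ → ℤ} (h : X 0 ≠ n) (k : ℤ) (l : Fin 3) (s : ℕ) :
    markAt n k l (s + 1) X = markAt n k l s (tail X) := by
  classical exact if_congr (by rw [avoids_succ]; exact and_iff_right h) rfl rfl

lemma markAt_of_eq {n : ℤ} {X : ℕ → ℤ} (h : X 0 = n) (k : ℤ) (l : Fin 3) (s : ℕ) :
    markAt n k l s X = 0 := by
  rw [markAt, if_neg]
  exact fun H => H 0 (Nat.zero_le _) h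

lemma count_zero (n k : ℤ) (l : Fin 3) (X : ℕ → ℤ) : count n k l 0 X = 0 := by simp [count]

lemma count_succ {n : ℤ} {X : ℕ → ℤ} (h : X 0 ≠ n) (k : ℤ) (l : Fin 3) (t : ℕ) :
    count n k l (t + 1) X = mark k l (X 0) (X 1) + count n k l t (tail X) := by
  simp only [count, Finset.sum_range_succ', markAt_zero h, markAt_succ h, add_comm]

lemma count_of_eq {n : ℤ} {X : ℕ → ℤ} (h : X 0 = n) (k : ℤ) (l : Fin 3) (t : ℕ) :
    count n k l t X = 0 :=
  Finset.sum_eq_zero fun s _ => markAt_of_eq h k l s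

lemma total_eq {n : ℤ} {X : ℕ → ℤ} (h : X 0 ≠ n) (k : ℤ) :
    total n k X = (fun l => mark k l (X 0) (X 1)) + total n k (tail X) := by
  funext l
  simp only [total, Pi.add_apply]
  rw [tsum_eq_zero_add' ENNReal.summable, markAt_zero h]
  simp only [markAt_succ h]

lemma total_of_eq {n : ℤ} {X : ℕ → ℤ} (h : X 0 = n) (k : ℤ) : total n k X = 0 := by
  funext l
  simp [total, markAt_of_eq h]

lemma below_succ {n : ℤ} {X : ℕ → ℤ} (h : X 0 ≠ n) (i : ℤ) (t : ℕ) :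
    below n i (t + 1) X = below n i t (tail X) := by
  classical exact if_congr (by rw [avoids_succ, and_iff_right h]; rfl) rfl rfl

lemma below_of_eq {n : ℤ} {X : ℕ → ℤ} (h : X 0 = n) (i : ℤ) (t : ℕ) : below n i t X = 0 := by
  rw [below, if_neg]
  exact fun H => H.1 0 (Nat.zero_le _) h

lemma tendsto_count (n k : ℤ) (l : Fin 3) (X : ℕ → ℤ) :
    Filter.Tendsto (fun t => count n k l t X) Filter.atTop (nhds (total n k X l)) :=
  ENNReal.tendsto_nat_tsum _

lemma monotone_count (n k : ℤ) (l : Fin 3) (X : ℕ → ℤ) : Monotone fun t => count n k l t X :=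
  fun _ _ h => Finset.sum_le_sum_of_subset (Finset.range_mono h)

lemma mark_step_zero (k x : ℤ) (j : Fin 3) :
    mark k 0 x (x + jump j) = if x = k ∧ j = 1 then 1 else 0 := by
  fin_cases j <;> simp [mark, jump, jumpFrom, jumpTo] <;> grind

lemma mark_step_one (k x : ℤ) (j : Fin 3) :
    mark k 1 x (x + jump j) = if x = k ∧ j = 0 then 1 else 0 := by
  fin_cases j <;> simp [mark, jump, jumpFrom, jumpTo] <;> grind

lemma mark_step_two (k x : ℤ) (j : Fin 3) :
    mark k 2 x (x + jump j) = if x = k + 1 ∧ j = 0 then 1 else 0 := by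
  fin_cases j <;> simp [mark, jump, jumpFrom, jumpTo] <;> grind

lemma mark_eq_zero {k x : ℤ} (h : x < k) (l : Fin 3) (y : ℤ) : mark k l x y = 0 := by
  rw [mark, if_neg]
  rintro ⟨h1, -⟩
  fin_cases l <;> simp [jumpFrom] at h1 <;> omega

lemma jump_le (j : Fin 3) : jump j ≤ 1 := by fin_cases j <;> simp [jump]

/-! ### Consequences of the Liouville property -/

/-- If dropping a first position `≤ i` does not change `F`, the mean of `F` is harmonic in the
starting point on `(-∞, i]` by the first-step decomposition. It is bounded, so `eq_of_harmonic`
applies. -/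
lemma lintegral_eq_of_shift_invariant {ω : Env} (hω : Good ω) {i : ℤ} {F : (ℕ → ℤ) → ℝ≥0∞}
    (hF : Measurable F) (hF1 : ∀ X, F X ≤ 1) (hs : ∀ X, X 0 ≤ i → F X = F (tail X))
    {x : ℤ} (hx : x ≤ i + 1) :
    ∫⁻ X, F X ∂(quenched ω x) = ∫⁻ X, F X ∂(quenched ω (i + 1)) := by
  have hle : ∀ y, ∫⁻ X, F X ∂(quenched ω y) ≤ 1 := fun y =>
    (lintegral_mono hF1).trans_eq (by simp)
  have hfin : ∀ y, ∫⁻ X, F X ∂(quenched ω y) ≠ ∞ := fun y => ne_top_of_le_ne_top (by simp) (hle y)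
  rw [← ENNReal.toReal_eq_toReal_iff' (hfin _) (hfin _)]
  refine eq_of_harmonic hω (g := fun y => (∫⁻ X, F X ∂(quenched ω y)).toReal) (C := 1) ?_ ?_ hx
  · intro y
    rw [abs_of_nonneg ENNReal.toReal_nonneg]
    exact ENNReal.toReal_le_of_le_ofReal zero_le_one (by simpa using hle y)
  · intro y hy
    rw [lintegral_quenched_tail ω y hF (fun _ => F) (fun j X h0 _ => hs X (h0.trans_le hy)),
      ENNReal.toReal_sum fun j _ => ENNReal.mul_ne_top ENNReal.ofReal_ne_top (hfin _)]
    refine Finset.sum_congr rfl fun j _ => ?_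
    rw [ENNReal.toReal_mul, ENNReal.toReal_ofReal (hω.pos y j).le]

/-- In a good environment the walk hits every site to the right of its starting point. -/
theorem ae_exists_hit {ω : Env} (hω : Good ω) {n x : ℤ} (hx : x ≤ n) :
    ∀ᵐ X ∂(quenched ω x), ∃ t, X t = n := by
  classical
  set S : Set (ℕ → ℤ) := {X | ∀ t, X t ≠ n} with hS
  have hSm : MeasurableSet S := by
    have : S = ⋂ t, {X | Avoids n t X} := by
      ext X
      simp only [hS, Set.mem_iInter, Set.mem_ofPred_eq, Avoids]
      exact ⟨fun h t s _ => h s, fun h t => h t t le_rfl⟩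
    rw [this]
    exact MeasurableSet.iInter fun t => measurableSet_avoids n t
  -- The probability of never visiting `n` is constant for starting points `≤ n`, and it is 0 from
  -- `n` itself.
  have h := lintegral_eq_of_shift_invariant hω (i := n - 1) (F := S.indicator 1)
    (measurable_one.indicator hSm) (fun X => Set.indicator_le_self' (by simp) X) ?_
    (x := x) (by omega)
  · rw [lintegral_indicator_one hSm, lintegral_indicator_one hSm, sub_add_cancel] at h
    have h0 : quenched ω n S = 0 := by
      rw [← nonpos_iff_eq_zero, ← (ae_iff.1 (ae_start ω n))]
      exact measure_mono fun X hX => hX 0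
    rw [h0] at h
    rw [ae_iff]
    convert h using 2
    ext X
    simp [hS]
  · intro X hX
    have : X ∈ S ↔ tail X ∈ S := by
      constructor
      · exact fun h t => h (t + 1)
      · intro h t
        cases t with
        | zero => omega
        | succ t => exact h t
    simp [Set.indicator_apply, this]

/-- Jumps at level `i + 1` start at `i + 1` or `i + 2`, so steps taken from sites `≤ i` leave these
counts unchanged. -/
lemma lintegral_total_eq {ω : Env} (hω : Good ω) {n i : ℤ} (hi : i < n)
    {φ : (Fin 3 → ℝ≥0∞) → ℝ≥0∞} (hφ : Measurable φ) (hφ1 : ∀ v, φ v ≤ 1) {x : ℤ}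
    (hx : x ≤ i + 1) :
    ∫⁻ X, φ (total n (i + 1) X) ∂(quenched ω x) =
      ∫⁻ X, φ (total n (i + 1) X) ∂(quenched ω (i + 1)) := by
  refine lintegral_eq_of_shift_invariant hω (F := fun X => φ (total n (i + 1) X))
    (hφ.comp (measurable_total _ _)) (fun X => hφ1 _) (fun X hX => ?_) hx
  rw [total_eq (by omega)]
  congr 1
  funext l
  simp [mark_eq_zero (show X 0 < i + 1 by omega)]

/-! ### The branching identity -/

/-- The matrix `A_k` with entries in `ℝ≥0∞`. -/
def meanMat (ω : Env) (k : ℤ) : Matrix (Fin 3) (Fin 3) ℝ≥0∞ := (A ω k).map ENNReal.ofReal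

/-- The additional 1 reflects that a type-2 jump at level `k + 1` is itself a type-3 jump at level
`k`. -/
lemma meanMat_one (ω : Env) (k : ℤ) (m : Fin 3) :
    meanMat ω k 1 m = meanMat ω k 0 m + if m = 2 then 1 else 0 := by
  fin_cases m <;> simp [meanMat, A]

lemma meanMat_two (ω : Env) (k : ℤ) (m : Fin 3) : meanMat ω k 2 m = meanMat ω k 0 m := by
  fin_cases m <;> simp [meanMat, A]

lemma ofReal_mul_div {p q : ℝ} (hp : 0 < p) :
    ENNReal.ofReal p * ENNReal.ofReal (q / p) = ENNReal.ofReal q := by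
  rw [← ENNReal.ofReal_mul hp.le, mul_div_cancel₀ _ hp.ne']

/-- The balance at level `k`: the expected number of type-`m` jumps in one step from `k`
compensates the possible end of the excursion below `k + 1`. -/
lemma balance {ω : Env} (hω : Good ω) (k : ℤ) (m : Fin 3) :
    ∑ j : Fin 3, ENNReal.ofReal ((ω k).1 j) *
      (mark k m k (k + jump j) + if k + jump j ≤ k then meanMat ω k 0 m else 0) =
      meanMat ω k 0 m := by
  have hs := sum_ofReal_env ω k
  rw [Fin.sum_univ_three] at hs
  have hp := hω.pos k 2
  -- This is where the quotients in `a_k`, `b_k` come from: a step up from `k` has probability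
  -- `ω_k(1)` and ends the excursion.
  have h0 : ∑ j : Fin 3, ENNReal.ofReal ((ω k).1 j) * mark k m k (k + jump j) =
      ENNReal.ofReal ((ω k).1 2) * meanMat ω k 0 m := by
    fin_cases m <;>
      simp [mark_step_zero, mark_step_one, mark_step_two, meanMat, A, a, b,
        ofReal_mul_div hp]
  simp only [mul_add, Finset.sum_add_distrib, h0]
  have h1 : ∑ j : Fin 3, ENNReal.ofReal ((ω k).1 j) *
      (if k + jump j ≤ k then meanMat ω k 0 m else 0) =
      (ENNReal.ofReal ((ω k).1 0) + ENNReal.ofReal ((ω k).1 1)) * meanMat ω k 0 m := by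
    simp [Fin.sum_univ_three, jump, add_mul]
  rw [h1, ← add_mul, add_comm, hs, one_mul]

/-- Away from level `i`, the balance holds for every step. -/
lemma balance_of_ne (ω : Env) {i x : ℤ} (hx : x ≠ i) (j m : Fin 3) :
    mark i m x (x + jump j) + (if x + jump j ≤ i then meanMat ω i 0 m else 0) =
      (if x ≤ i then meanMat ω i 0 m else 0) +
        ∑ l, mark (i + 1) l x (x + jump j) * meanMat ω i l m := by
  rw [Fin.sum_univ_three, mark_step_zero, mark_step_one, mark_step_two, meanMat_one, meanMat_two]
  rcases lt_or_gt_of_ne hx with h | h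
  · have h1 := jump_le j
    rw [mark_eq_zero h, if_pos (show x + jump j ≤ i by omega), if_pos h.le]
    simp [show x ≠ i + 1 by omega, show x ≠ i + 1 + 1 by omega]
  · have hm : mark i m x (x + jump j) = if x = i + 1 ∧ j = 0 ∧ m = 2 then 1 else 0 := by
      fin_cases m
      · simp [mark_step_zero, h.ne']
      · simp [mark_step_one, h.ne']
      · simp [mark_step_two]
    rw [hm, if_neg (show ¬ x ≤ i by omega)]
    -- From above `i` the walk enters `(-∞, i]` exactly by a jump at level `i + 1`: types 1 and 2
    -- from `i + 1`, type 3 from `i + 2`.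
    by_cases h1 : x = i + 1
    · subst h1
      fin_cases j <;> simp [jump, add_comm]; omega
    · by_cases h2 : x = i + 2
      · subst h2
        fin_cases j <;> simp [jump]; omega
      · have h3 : ¬ x + jump j ≤ i := by
          fin_cases j <;> simp [jump] <;> omega
        rw [if_neg h3]
        simp [h1, show x ≠ i + 1 + 1 by omega]

/-- The term with `below` is the expected number of type-`m` jumps still owed by an excursion
running at time `t`; it does not depend on where below `i + 1` the walk is. The induction must cover
all `φ` and `x` at once, since the first step moves the walk and shifts the argument of `φ`. -/
lemma truncated_identity {ω : Env} (hω : Good ω) {n i : ℤ} (hi : i < n) (m : Fin 3) (t : ℕ) :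
    ∀ φ : (Fin 3 → ℝ≥0∞) → ℝ≥0∞, Measurable φ → (∀ v, φ v ≤ 1) → ∀ x ≤ n,
    ∫⁻ X, (count n i m t X + meanMat ω i 0 m * below n i t X) * φ (total n (i + 1) X)
        ∂(quenched ω x) =
      (if x ≤ i then meanMat ω i 0 m else 0) * ∫⁻ X, φ (total n (i + 1) X) ∂(quenched ω x) +
      ∫⁻ X, (∑ l, count n (i + 1) l t X * meanMat ω i l m) * φ (total n (i + 1) X)
        ∂(quenched ω x) := by
  induction t with
  | zero =>
    intro φ hφ _ x hx
    simp only [count_zero, zero_mul, Finset.sum_const_zero, lintegral_zero, add_zero, zero_add]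
    rw [← lintegral_const_mul _ (by fun_prop)]
    refine lintegral_congr_ae ?_
    filter_upwards [ae_start ω x] with X hX
    have : below n i 0 X = if x ≤ i then 1 else 0 := by
      classical refine if_congr ?_ rfl rfl
      rw [avoids_zero, hX]
      exact ⟨fun h => h.2, fun h => ⟨by omega, h⟩⟩
    rw [this]
    split_ifs <;> simp
  | succ t ih =>
    intro φ hφ hφ1 x hx
    rcases hx.eq_or_lt with rfl | hxn
    · rw [if_neg (by omega), zero_mul, zero_add]
      refine lintegral_congr_ae ?_
      filter_upwards [ae_start ω x] with X hX
      simp [count_of_eq hX, below_of_eq hX]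
    let v : Fin 3 → Fin 3 → ℝ≥0∞ := fun j l => mark (i + 1) l x (x + jump j)
    let ψ : Fin 3 → (Fin 3 → ℝ≥0∞) → ℝ≥0∞ := fun j u => φ (v j + u)
    have hψ : ∀ j, Measurable (ψ j) := fun j => by fun_prop
    have hψ1 : ∀ j u, ψ j u ≤ 1 := fun j u => hφ1 _
    have hφt : ∀ j X, X 0 = x → X 1 = x + jump j →
        φ (total n (i + 1) X) = ψ j (total n (i + 1) (tail X)) := fun j X h0 h1 => by
      rw [total_eq (by omega), h0, h1]
    have e1 := lintegral_quenched_tail ω x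
      (F := fun X => (count n i m (t + 1) X + meanMat ω i 0 m * below n i (t + 1) X) *
        φ (total n (i + 1) X)) (by fun_prop)
      (fun j Y => mark i m x (x + jump j) * ψ j (total n (i + 1) Y) +
        (count n i m t Y + meanMat ω i 0 m * below n i t Y) * ψ j (total n (i + 1) Y))
      (fun j X h0 h1 => by
        rw [count_succ (by omega), below_succ (by omega), h0, h1, hφt j X h0 h1]; ring)
    have e2 := lintegral_quenched_tail ω x
      (F := fun X => φ (total n (i + 1) X)) (by fun_prop)
      (fun j Y => ψ j (total n (i + 1) Y)) hφt
    have e3 := lintegral_quenched_tail ω x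
      (F := fun X => (∑ l, count n (i + 1) l (t + 1) X * meanMat ω i l m) *
        φ (total n (i + 1) X)) (by fun_prop)
      (fun j Y => (∑ l, v j l * meanMat ω i l m) * ψ j (total n (i + 1) Y) +
        (∑ l, count n (i + 1) l t Y * meanMat ω i l m) * ψ j (total n (i + 1) Y))
      (fun j X h0 h1 => by
        have : ∀ l, count n (i + 1) l (t + 1) X = v j l + count n (i + 1) l t (tail X) :=
          fun l => by rw [count_succ (by omega), h0, h1]
        simp only [this, hφt j X h0 h1, add_mul, Finset.sum_add_distrib])
    have hy : ∀ j, x + jump j ≤ n := fun j => by have := jump_le j; omega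
    have ih' := fun j => ih (ψ j) (hψ j) (hψ1 j) (x + jump j) (hy j)
    rw [e1, e2, e3]
    have m1 : ∀ j, Measurable fun Y => ψ j (total n (i + 1) Y) := fun j => by fun_prop
    simp only [lintegral_add_left ((m1 _).const_mul _), lintegral_const_mul _ (m1 _), ih',
      Finset.mul_sum, ← Finset.sum_add_distrib]
    -- At `x = i` the balance holds only after averaging over the step. That is enough: a step from
    -- `i` is no jump at level `i + 1`, so `φ` is not shifted, and by `lintegral_total_eq` its mean
    -- is the same after each of the three steps.
    by_cases hxi : x = i
    · have hv : ∀ j, v j = 0 := fun j => funext fun l => mark_eq_zero (by omega) _ _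
      have hψφ : ∀ j, ψ j = φ := fun j => by funext u; simp only [ψ, hv, zero_add]
      have hc : ∀ j, ∫⁻ Y, ψ j (total n (i + 1) Y) ∂(quenched ω (x + jump j)) =
          ∫⁻ X, φ (total n (i + 1) X) ∂(quenched ω (i + 1)) := fun j => by
        have := jump_le j
        simp only [hψφ]
        exact lintegral_total_eq hω hi hφ hφ1 (by omega)
      have hb := balance hω i m
      have hs := sum_ofReal_env ω i
      subst hxi
      simp only [hc, hv, Pi.zero_apply, zero_mul, Finset.sum_const_zero, zero_add, le_refl, if_true]
      simp only [← add_assoc, mul_add, Finset.sum_add_distrib]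
      congr 1
      simp only [← Finset.sum_add_distrib, ← mul_assoc, ← add_mul, ← Finset.sum_mul, ← mul_add, hb,
        hs, ← Finset.mul_sum, mul_one]
    · refine Finset.sum_congr rfl fun j _ => ?_
      have hb := balance_of_ne ω hxi j m
      calc _ = ENNReal.ofReal ((ω x).1 j) * ((mark i m x (x + jump j) +
            if x + jump j ≤ i then meanMat ω i 0 m else 0) *
              ∫⁻ X, ψ j (total n (i + 1) X) ∂(quenched ω (x + jump j)) +
            ∫⁻ X, (∑ l, count n (i + 1) l t X * meanMat ω i l m) * ψ j (total n (i + 1) X)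
              ∂(quenched ω (x + jump j))) := by ring
        _ = _ := by rw [hb]; ring

/-- The branching identity, in integrated form: the expectation of the number of type-`m` jumps
at level `i` on an event which is determined by the jumps at level `i + 1`. -/
theorem branching_identity {ω : Env} (hω : Good ω) {n i : ℤ} (hi : i < n) (m : Fin 3)
    {φ : (Fin 3 → ℝ≥0∞) → ℝ≥0∞} (hφ : Measurable φ) (hφ1 : ∀ v, φ v ≤ 1) {x : ℤ} (hx : x ≤ n) :
    ∫⁻ X, total n i X m * φ (total n (i + 1) X) ∂(quenched ω x) =
      (if x ≤ i then meanMat ω i 0 m else 0) * ∫⁻ X, φ (total n (i + 1) X) ∂(quenched ω x) +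
      ∫⁻ X, (∑ l, total n (i + 1) X l * meanMat ω i l m) * φ (total n (i + 1) X)
        ∂(quenched ω x) := by
  have hmono : ∀ {f : ℕ → (ℕ → ℤ) → ℝ≥0∞} {F : (ℕ → ℤ) → ℝ≥0∞}, (∀ t, Measurable (f t)) →
      (∀ X, Monotone fun t => f t X) →
      (∀ X, Filter.Tendsto (fun t => f t X) Filter.atTop (nhds (F X))) →
      Filter.Tendsto (fun t => ∫⁻ X, f t X ∂(quenched ω x)) Filter.atTop
        (nhds (∫⁻ X, F X ∂(quenched ω x))) := fun hf hm hl =>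
    lintegral_tendsto_of_tendsto_of_monotone (fun t => (hf t).aemeasurable)
      (Filter.Eventually.of_forall hm) (Filter.Eventually.of_forall hl)
  have hφtop : ∀ v, φ v ≠ ∞ := fun v => ne_top_of_le_ne_top ENNReal.one_ne_top (hφ1 v)
  have t1 := hmono (f := fun t X => count n i m t X * φ (total n (i + 1) X))
    (F := fun X => total n i X m * φ (total n (i + 1) X)) (fun t => by fun_prop)
    (fun X s t h => mul_le_mul_left (monotone_count n i m X h) _)
    (fun X => ENNReal.Tendsto.mul_const (tendsto_count n i m X) (Or.inr (hφtop _)))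
  have hAtop : ∀ l, meanMat ω i l m ≠ ∞ := fun l => ENNReal.ofReal_ne_top
  have t3 := hmono
    (f := fun t X => (∑ l, count n (i + 1) l t X * meanMat ω i l m) * φ (total n (i + 1) X))
    (F := fun X => (∑ l, total n (i + 1) X l * meanMat ω i l m) * φ (total n (i + 1) X))
    (fun t => by fun_prop)
    (fun X s t h => mul_le_mul_left (Finset.sum_le_sum fun l _ =>
      mul_le_mul_left (monotone_count n (i + 1) l X h) _) _)
    (fun X => ENNReal.Tendsto.mul_const (tendsto_finsetSum _ fun l _ =>
      ENNReal.Tendsto.mul_const (tendsto_count n (i + 1) l X) (Or.inr (hAtop l)))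
      (Or.inr (hφtop _)))
  -- The correction is bounded by a constant and vanishes once `n` has been visited, which happens
  -- almost surely.
  have t2 : Filter.Tendsto (fun t => ∫⁻ X, meanMat ω i 0 m * below n i t X *
      φ (total n (i + 1) X) ∂(quenched ω x)) Filter.atTop (nhds 0) := by
    have := tendsto_lintegral_of_dominated_convergence (μ := quenched ω x)
      (F := fun t X => meanMat ω i 0 m * below n i t X * φ (total n (i + 1) X)) (f := fun _ => 0)
      (fun _ => meanMat ω i 0 m) (fun t => by fun_prop) ?_ (by simp [hAtop 0]) ?_
    · simpa using this
    · intro t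
      refine Filter.Eventually.of_forall fun X => ?_
      have h1 : below n i t X ≤ 1 := by unfold below; split_ifs <;> simp
      calc _ ≤ meanMat ω i 0 m * 1 * 1 := by
            exact mul_le_mul' (mul_le_mul_right h1 _) (hφ1 _)
        _ = _ := by simp
    · filter_upwards [ae_exists_hit hω hx] with X hX
      obtain ⟨s, hs⟩ := hX
      refine tendsto_const_nhds.congr' ?_
      filter_upwards [Filter.eventually_ge_atTop s] with t ht
      rw [below, if_neg]
      · simp
      · exact fun h => h.1 s ht hs
  have h := fun t => truncated_identity hω hi m t φ hφ hφ1 x hx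
  have h' : ∀ t, ∫⁻ X, count n i m t X * φ (total n (i + 1) X) ∂(quenched ω x) +
      ∫⁻ X, meanMat ω i 0 m * below n i t X * φ (total n (i + 1) X) ∂(quenched ω x) =
      (if x ≤ i then meanMat ω i 0 m else 0) * ∫⁻ X, φ (total n (i + 1) X) ∂(quenched ω x) +
      ∫⁻ X, (∑ l, count n (i + 1) l t X * meanMat ω i l m) * φ (total n (i + 1) X)
        ∂(quenched ω x) := fun t => by
    rw [← h t, ← lintegral_add_left (by fun_prop)]
    simp only [add_mul]
  have hlim := t1.add t2
  rw [add_zero] at hlim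
  simp only [h'] at hlim
  exact tendsto_nhds_unique hlim (tendsto_const_nhds.add t3)

/-! ### The step counts of the path in terms of `total` -/

lemma natCast_lt_hit_iff (n : ℤ) (X : ℕ → ℤ) (k : ℕ) :
    (k : ℕ∞) < hit n X ↔ ∀ t, 0 < t → t ≤ k → X t ≠ n := by
  constructor
  · intro h t h0 htk htn
    have : hit n X ≤ t := iInf₂_le t ⟨h0, htn⟩
    exact absurd (h.trans_le this) (not_lt.2 (by exact_mod_cast htk))
  · intro h
    have : ((k + 1 : ℕ) : ℕ∞) ≤ hit n X := le_iInf₂ fun t ht => by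
      by_contra hlt
      have : t < k + 1 := by exact_mod_cast not_le.1 hlt
      exact h t ht.1 (by omega) ht.2
    exact lt_of_lt_of_le (by exact_mod_cast Nat.lt_succ_self k) this

lemma natCast_succ_lt_hit_iff (n : ℤ) (X : ℕ → ℤ) (k : ℕ) :
    ((k + 1 : ℕ) : ℕ∞) < hit n X ↔ Avoids n k (tail X) := by
  rw [natCast_lt_hit_iff]
  constructor
  · exact fun h s hs => h (s + 1) (by omega) (by omega)
  · intro h t h0 ht
    obtain ⟨s, rfl⟩ : ∃ s, t = s + 1 := ⟨t - 1, by omega⟩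
    exact h s (by omega)

-- `U` counts steps by their end time, and `hit` ignores time 0; both effects are captured by
-- letting the tail, rather than the path, avoid `n`.
open Classical in
lemma U_eq_tsum (n k : ℤ) (X : ℕ → ℤ) (l : Fin 3) :
    ((U n k X l : ℕ∞) : ℝ≥0∞) =
      ∑' s, if Avoids n s (tail X) then mark k l (X s) (X (s + 1)) else 0 := by
  set S : Set ℕ := {s | Avoids n s (tail X) ∧ X s = jumpFrom k l ∧ X (s + 1) = jumpTo k l}
    with hS
  have h1 : {r : ℕ | 0 < r ∧ (r : ℕ∞) < hit n X ∧ X (r - 1) = jumpFrom k l ∧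
      X r = jumpTo k l} = Nat.succ '' S := by
    ext r
    cases r with
    | zero => simp
    | succ r =>
      simp only [Set.mem_ofPred_eq, Nat.succ_pos, true_and, natCast_succ_lt_hit_iff,
        Nat.add_sub_cancel, Set.mem_image, hS]
      constructor
      · exact fun h => ⟨r, h, rfl⟩
      · rintro ⟨s, hs, h⟩
        obtain rfl : s = r := Nat.succ_injective h
        exact hs
  rw [U, stepCount, h1, Nat.succ_injective.encard_image, ← ENNReal.tsum_set_one,
    tsum_subtype S (fun _ => (1 : ℝ≥0∞))]
  refine tsum_congr fun s => ?_
  by_cases h : Avoids n s (tail X) <;> simp [hS, mark, h, Set.indicator_apply]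

lemma measurable_U (n k : ℤ) (l : Fin 3) :
    Measurable fun X => ((U n k X l : ℕ∞) : ℝ≥0∞) := by
  classical
  simp only [U_eq_tsum]
  refine Measurable.tsum fun s => Measurable.ite
    (measurable_tail (measurableSet_avoids n s)) ?_ measurable_const
  have : Measurable fun p : ℤ × ℤ => mark k l p.1 p.2 := measurable_of_countable _
  exact this.comp (f := fun X : ℕ → ℤ => (X s, X (s + 1)))
    ((measurable_pi_apply s).prodMk (measurable_pi_apply (s + 1)))

lemma jumpTo_lt (k : ℤ) (l : Fin 3) : jumpTo k l < k := by
  fin_cases l <;> simp [jumpTo]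

lemma mark_eq_zero_of_le {n k : ℤ} (hk : k ≤ n) (l : Fin 3) (x : ℤ) : mark k l x n = 0 := by
  rw [mark, if_neg]
  rintro ⟨-, h⟩
  have := jumpTo_lt k l
  omega

/-- `U` and `total` differ only over a step into `n`, and such a step is no jump at a level `k ≤ n`.
The first step is kept apart because an excursion may start at `n` itself, where `total` is zero. -/
lemma U_eq_mark_add {n k : ℤ} (hk : k ≤ n) {X : ℕ → ℤ} (h : X 1 ≠ n) (l : Fin 3) :
    ((U n k X l : ℕ∞) : ℝ≥0∞) = mark k l (X 0) (X 1) + total n k (tail X) l := by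
  classical
  rw [U_eq_tsum, tsum_eq_zero_add' ENNReal.summable, if_pos (avoids_zero.2 h), total]
  congr 1
  refine tsum_congr fun s => ?_
  by_cases hs : X (s + 2) = n
  · rw [if_neg fun H => H (s + 1) le_rfl hs]
    have : mark k l (tail X s) (tail X (s + 1)) = 0 := by
      rw [show tail X (s + 1) = n from hs, mark_eq_zero_of_le hk]
    simp [markAt, this]
  · refine if_congr ⟨fun H r hr => H r (by omega), fun H r hr => ?_⟩ rfl rfl
    rcases hr.eq_or_lt with rfl | hr
    · exact hs
    · exact H r (by omega)

lemma U_eq_total {n k : ℤ} (hk : k ≤ n) {X : ℕ → ℤ} (h : X 0 ≠ n) (l : Fin 3) :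
    ((U n k X l : ℕ∞) : ℝ≥0∞) = total n k X l := by
  classical
  by_cases h1 : X 1 = n
  · rw [total_eq h, h1, total_of_eq (X := tail X) h1, U_eq_tsum]
    have : ∀ s, ¬ Avoids n s (tail X) := fun s H => H 0 (Nat.zero_le _) h1
    simp [this, mark_eq_zero_of_le hk]
  · rw [U_eq_mark_add hk h1, total_eq h]
    rfl

/-! ### Paths with steps `-2`, `-1`, `1` -/

/-- All steps of the path are possible displacements of the walk. -/
def Legal (X : ℕ → ℤ) : Prop := ∀ t, ∃ j, X (t + 1) = X t + jump j

lemma ae_quenched_of_ae_cons (ω : Env) (x : ℤ) {p : (ℕ → ℤ) → Prop}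
    (hp : MeasurableSet {X | p X})
    (h : ∀ j, ∀ᵐ Y ∂(quenched ω (x + jump j)), p (cons x Y)) :
    ∀ᵐ X ∂(quenched ω x), p X := by
  rw [ae_iff, quenched_eq_sum]
  simp only [Measure.coe_finsetSum, Finset.sum_apply, Measure.smul_apply, smul_eq_mul]
  refine Finset.sum_eq_zero fun j _ => ?_
  have hc : MeasurableSet {X | ¬ p X} := hp.compl
  rw [Measure.map_apply (measurable_cons x) hc]
  exact mul_eq_zero_of_right _ (h j)

lemma ae_legal (ω : Env) (x : ℤ) : ∀ᵐ X ∂(quenched ω x), Legal X := by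
  refine ae_all_iff.2 fun t => ?_
  have hm : ∀ t, MeasurableSet {X : ℕ → ℤ | ∃ j, X (t + 1) = X t + jump j} := fun t => by
    have h : MeasurableSet {p : ℤ × ℤ | ∃ j, p.2 = p.1 + jump j} := Set.Countable.measurableSet
      (Set.to_countable _)
    exact measurableSet_preimage (f := fun X : ℕ → ℤ => (X t, X (t + 1)))
      ((measurable_pi_apply t).prodMk (measurable_pi_apply (t + 1))) h
  induction t generalizing x with
  | zero =>
    refine ae_quenched_of_ae_cons ω x (hm 0) fun j => ?_
    filter_upwards [ae_start ω (x + jump j)] with Y hY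
    exact ⟨j, hY⟩
  | succ t ih => exact ae_quenched_of_ae_cons ω x (hm (t + 1)) fun j => ih (x + jump j)

lemma Legal.tail {X : ℕ → ℤ} (h : Legal X) : Legal (tail X) := fun t => h (t + 1)

/-- Upward steps have size one, so `n` cannot be jumped over. -/
lemma Legal.lt_of_avoids {X : ℕ → ℤ} (h : Legal X) {n : ℤ} (h0 : X 0 ≤ n) {t : ℕ}
    (ht : Avoids n t X) : X t < n := by
  induction t with
  | zero => exact lt_of_le_of_ne h0 (ht 0 le_rfl)
  | succ t ih =>
    have h1 := ih fun s hs => ht s (by omega)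
    have h2 := ht (t + 1) le_rfl
    obtain ⟨j, hj⟩ := h t
    have := jump_le j
    omega

lemma Legal.total_eq_zero {X : ℕ → ℤ} (h : Legal X) {n k : ℤ} (h0 : X 0 ≤ n) (hk : n ≤ k) :
    total n k X = 0 := by
  funext l
  refine ENNReal.tsum_eq_zero.2 fun s => ?_
  rw [markAt]
  split_ifs with hs
  · exact mark_eq_zero (by have := h.lt_of_avoids h0 hs; omega) _ _
  · rfl

lemma lintegral_total_eq_zero (ω : Env) {n k x : ℤ} (hx : x ≤ n) (hk : n ≤ k) (m : Fin 3) :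
    ∫⁻ X, total n k X m ∂(quenched ω x) = 0 := by
  rw [lintegral_eq_zero_iff (by fun_prop)]
  filter_upwards [ae_legal ω x, ae_start ω x] with X hX h0
  simp [hX.total_eq_zero (h0.trans_le hx) hk]

lemma lintegral_total_mean {ω : Env} (hω : Good ω) {n i : ℤ} (hi : i < n) (m : Fin 3) {x : ℤ}
    (hx : x ≤ n) :
    ∫⁻ X, total n i X m ∂(quenched ω x) = (if x ≤ i then meanMat ω i 0 m else 0) +
      ∑ l, (∫⁻ X, total n (i + 1) X l ∂(quenched ω x)) * meanMat ω i l m := by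
  have h := branching_identity hω hi m (φ := fun _ => 1) measurable_const (fun _ => le_rfl) hx
  simp only [mul_one, lintegral_const, measure_univ] at h
  rw [h, lintegral_finsetSum _ fun l _ => by fun_prop]
  congr 1
  exact Finset.sum_congr rfl fun l _ => lintegral_mul_const _ (by fun_prop)

/-! ### Conditional expectations -/

lemma lintegral_cond_eq {μ : Measure (ℕ → ℤ)} (s : Set (ℕ → ℤ)) (f : (ℕ → ℤ) → ℝ≥0∞) :
    ∫⁻ X, f X ∂(μ[|s]) = (μ s)⁻¹ * ∫⁻ X in s, f X ∂μ := by
  rw [ProbabilityTheory.cond, lintegral_smul_measure, smul_eq_mul]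

/-- The displacement of a jump of type `l`, as an index. -/
def typeIndex : Fin 3 → Fin 3 := ![1, 0, 0]

lemma jumpTo_eq (k : ℤ) (l : Fin 3) : jumpTo k l = jumpFrom k l + jump (typeIndex l) := by
  fin_cases l <;> simp [jumpTo, jumpFrom, jump, typeIndex] <;> ring

lemma jump_injective : Function.Injective jump := by decide

/-- Given its first step, the excursion continues as a walk from `y ≤ i` until `i + 1`. It makes no
further jump at level `i + 1`, so the branching identity with `φ = 1` leaves only the first row of
`A_i`, to which the first step may add one child. -/
theorem meanOffspring_eq {ω : Env} (hω : Good ω) (i : ℤ) :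
    meanOffspring ω i = (A ω i).map ENNReal.ofReal := by
  ext l m
  set x := jumpFrom (i + 1) l with hx
  set y := jumpTo (i + 1) l with hy
  set E : Set (ℕ → ℤ) := {X | X 1 = y} with hE
  have hEm : MeasurableSet E := measurable_pi_apply (X := fun _ : ℕ => ℤ) 1
    (measurableSet_singleton y)
  have hyx : y = x + jump (typeIndex l) := jumpTo_eq _ _
  have hmem : ∀ j X, X 1 = x + jump j → (X ∈ E ↔ j = typeIndex l) := fun j X h1 => by
    rw [hE, Set.mem_ofPred_eq, h1, hyx, add_right_inj, jump_injective.eq_iff]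
  have hyi : y < i + 1 := jumpTo_lt _ _
  have hPE : quenched ω x E = ENNReal.ofReal ((ω x).1 (typeIndex l)) := by
    rw [← lintegral_indicator_one hEm, lintegral_quenched_tail ω x (measurable_one.indicator hEm)
      (fun j _ => if j = typeIndex l then 1 else 0)
      (fun j X _ h1 => by simp [Set.indicator_apply, hmem j X h1])]
    simp
  have hint : ∫⁻ X in E, ((U (i + 1) i X m : ℕ∞) : ℝ≥0∞) ∂(quenched ω x) =
      ENNReal.ofReal ((ω x).1 (typeIndex l)) * (mark i m x y + meanMat ω i 0 m) := by
    rw [← lintegral_indicator hEm, lintegral_quenched_tail ω x ((measurable_U _ _ _).indicator hEm)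
      (fun j Y => if j = typeIndex l then mark i m x y + total (i + 1) i Y m else 0) ?_]
    · rw [Finset.sum_eq_single (typeIndex l) (fun j _ hj => by simp [hj]) (by simp), ← hyx]
      simp only [if_true]
      rw [lintegral_add_left measurable_const, lintegral_const, measure_univ, mul_one,
        lintegral_total_mean hω (by omega) m hyi.le, if_pos (by omega)]
      simp [lintegral_total_eq_zero ω hyi.le le_rfl]
    · intro j X h0 h1
      rw [Set.indicator_apply]
      refine if_ctx_congr (hmem j X h1) (fun hj => ?_) (fun _ => rfl)
      have h1' : X 1 = y := by rw [h1, hyx, hj]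
      rw [U_eq_mark_add (by omega) (by omega), h0, h1']
  change ∫⁻ X, ((U (i + 1) i X m : ℕ∞) : ℝ≥0∞) ∂((quenched ω x)[|E]) = meanMat ω i l m
  rw [lintegral_cond_eq, hPE, hint, ← mul_assoc, ENNReal.inv_mul_cancel
    (ENNReal.ofReal_pos.2 (hω.pos _ _)).ne' ENNReal.ofReal_ne_top, one_mul]
  -- The first step is itself a child only for a type-2 individual, and then of type 3.
  have hb : mark i m x y = if l = 1 ∧ m = 2 then 1 else 0 := by
    rw [hyx, hx]
    fin_cases m
    · fin_cases l <;> simp [mark_step_zero, jumpFrom, typeIndex]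
    · fin_cases l <;> simp [mark_step_one, jumpFrom, typeIndex]; omega
    · fin_cases l <;> simp [mark_step_two, jumpFrom, typeIndex]
  rw [hb]
  fin_cases l
  · simp
  · simp [meanMat_one, add_comm]
  · simp [meanMat_two]

/-- In `branching_identity`, `φ` is the indicator of the point `u`. The immigrant is the term for a
start at or below `i`, here `0 ≤ i`. -/
theorem lintegral_cond_levelEvent {ω : Env} (hω : Good ω) {n : ℕ} (hn : 1 ≤ n) {i : ℤ}
    (hi : i < n) (u : Fin 3 → ℕ) (hu : quenched ω 0 (levelEvent n (i + 1) u) ≠ 0) (m : Fin 3) :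
    ∫⁻ X, ((U n i X m : ℕ∞) : ℝ≥0∞) ∂((quenched ω 0)[|levelEvent n (i + 1) u]) =
      ENNReal.ofReal ((((fun l => (u l : ℝ)) + immigrant i) ᵥ* A ω i) m) := by
  classical
  set E := levelEvent n (i + 1) u with hE
  let w : Fin 3 → ℝ≥0∞ := fun l => (u l : ℝ≥0∞)
  let φ : (Fin 3 → ℝ≥0∞) → ℝ≥0∞ := fun v => if v = w then 1 else 0
  have hφ : Measurable φ :=
    Measurable.ite (measurableSet_singleton w) measurable_const measurable_const
  have hφ1 : ∀ v, φ v ≤ 1 := fun v => by simp only [φ]; split_ifs <;> simp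
  have hEm : MeasurableSet E := by
    have : E = ⋂ l, (fun X => ((U n (i + 1) X l : ℕ∞) : ℝ≥0∞)) ⁻¹' {w l} := by
      ext X
      simp only [hE, levelEvent, Set.mem_ofPred_eq, Set.mem_iInter, Set.mem_preimage,
        Set.mem_singleton_iff, w]
      refine forall_congr' fun l => ?_
      rw [← ENat.toENNReal_coe, ENat.toENNReal_inj]
    rw [this]
    exact MeasurableSet.iInter fun l => measurable_U _ _ _ (measurableSet_singleton _)
  have hmem : ∀ X : ℕ → ℤ, X 0 = 0 → (X ∈ E ↔ total n (i + 1) X = w) := fun X h0 => by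
    simp only [hE, levelEvent, Set.mem_ofPred_eq, funext_iff, w]
    refine forall_congr' fun l => ?_
    rw [← U_eq_total (by omega) (by omega), ← ENat.toENNReal_coe, ENat.toENNReal_inj]
  have hP : ∫⁻ X, φ (total n (i + 1) X) ∂(quenched ω 0) = quenched ω 0 E := by
    rw [← lintegral_indicator_one hEm]
    refine lintegral_congr_ae ?_
    filter_upwards [ae_start ω 0] with X hX
    simp [φ, Set.indicator_apply, hmem X hX]
  have hL : ∫⁻ X in E, ((U n i X m : ℕ∞) : ℝ≥0∞) ∂(quenched ω 0) =
      ∫⁻ X, total n i X m * φ (total n (i + 1) X) ∂(quenched ω 0) := by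
    rw [← lintegral_indicator hEm]
    refine lintegral_congr_ae ?_
    filter_upwards [ae_start ω 0] with X hX
    simp only [φ, Set.indicator_apply, hmem X hX,
      U_eq_total hi.le (show X 0 ≠ n by omega)]
    split_ifs <;> simp
  have hR : ∫⁻ X, (∑ l, total n (i + 1) X l * meanMat ω i l m) * φ (total n (i + 1) X)
      ∂(quenched ω 0) = (∑ l, w l * meanMat ω i l m) * quenched ω 0 E := by
    rw [← hP, ← lintegral_const_mul _ (by fun_prop)]
    refine lintegral_congr fun X => ?_
    simp only [φ]
    split_ifs with h
    · rw [h]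
    · simp
  rw [lintegral_cond_eq, hL, branching_identity hω hi m hφ hφ1 (by omega), hP, hR, ← add_mul,
    mul_comm, mul_assoc, ENNReal.mul_inv_cancel hu (measure_ne_top _ _), mul_one]
  rw [Matrix.add_vecMul, Pi.add_apply, ENNReal.ofReal_add, add_comm]
  · congr 1
    · rw [Matrix.vecMul, dotProduct, ENNReal.ofReal_sum_of_nonneg fun l _ =>
        mul_nonneg (Nat.cast_nonneg _) (A_nonneg _ _ _ _)]
      refine Finset.sum_congr rfl fun l _ => ?_
      rw [ENNReal.ofReal_mul (Nat.cast_nonneg _), ENNReal.ofReal_natCast]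
      rfl
    · rw [immigrant]
      split_ifs
      · simp [meanMat]
      · simp
  · rw [Matrix.vecMul, dotProduct]
    exact Finset.sum_nonneg fun l _ => mul_nonneg (Nat.cast_nonneg _) (A_nonneg _ _ _ _)
  · rw [immigrant]
    split_ifs
    · simpa using A_nonneg _ _ _ _
    · simp

/-! ### The expected hitting time -/

/-- The sum over all levels of the scalar products of the step counts with `(2, 1, 2)`. -/
def backSteps (n : ℤ) (X : ℕ → ℤ) : ℝ≥0∞ :=
  ∑' k : ℤ, (2 * total n k X 0 + total n k X 1 + 2 * total n k X 2)

lemma backSteps_of_eq {n : ℤ} {X : ℕ → ℤ} (h : X 0 = n) : backSteps n X = 0 := by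
  simp [backSteps, total_of_eq h]

/-- A step of `-d` costs `d + 1` units of time beyond the distance: itself and the `d` steps that
make up for it. A step `-1` is one type-1 jump, of weight 2; a step `-2` is of type 2 at its level
and of type 3 one level lower, `1 + 2 = 3` in all. -/
lemma tsum_mark (x : ℤ) (j : Fin 3) :
    ∑' k : ℤ, (2 * mark k 0 x (x + jump j) + mark k 1 x (x + jump j) +
      2 * mark k 2 x (x + jump j)) = ((![3, 2, 0] j : ℕ) : ℝ≥0∞) := by
  have h : ∀ y : ℤ, ∑' k : ℤ, (if y = k then (1 : ℝ≥0∞) else 0) = 1 := fun y => by simp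
  have h' : ∀ k, x = k + 1 ↔ x - 1 = k := fun k => by omega
  simp only [mark_step_zero, mark_step_one, mark_step_two, h']
  fin_cases j
  · simp [ENNReal.tsum_add, h]; norm_num
  · simp
  · simp

lemma backSteps_eq {n : ℤ} {X : ℕ → ℤ} (h : X 0 ≠ n) {j : Fin 3} (hj : X 1 = X 0 + jump j) :
    backSteps n X = ((![3, 2, 0] j : ℕ) : ℝ≥0∞) + backSteps n (tail X) := by
  rw [← tsum_mark (X 0), backSteps, backSteps, ← ENNReal.tsum_add]
  refine tsum_congr fun k => ?_
  rw [total_eq h, hj]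
  simp only [Pi.add_apply]
  ring

/-- The first time at which a path from `x ≤ n` visits `n`, as the distance `n - x` plus a
weighted number of backward steps. -/
lemma Legal.time_eq {n : ℤ} {t : ℕ} {X : ℕ → ℤ} (hX : Legal X) (h0 : X 0 ≤ n) (ht : X t = n)
    (hlt : ∀ s < t, X s ≠ n) : (t : ℝ≥0∞) = ((n - X 0).toNat : ℕ) + backSteps n X := by
  induction t generalizing X with
  | zero => simp [backSteps_of_eq ht, ht]
  | succ t ih =>
    have hn0 : X 0 ≠ n := hlt 0 (Nat.succ_pos _)
    obtain ⟨j, hj⟩ := hX 0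
    rw [zero_add] at hj
    have hle := jump_le j
    have h1 : RWRE21.tail X 0 = X 0 + jump j := hj
    have h := ih hX.tail (by omega) ht fun s hs => hlt (s + 1) (by omega)
    rw [backSteps_eq hn0 hj, Nat.cast_succ, h, h1]
    have hnat : (n - (X 0 + jump j)).toNat + 1 = (n - X 0).toNat + ![3, 2, 0] j := by
      fin_cases j <;> simp [jump] <;> omega
    have hcast := congrArg (Nat.cast : ℕ → ℝ≥0∞) hnat
    push_cast at hcast
    rw [add_right_comm, hcast, add_assoc]

lemma Legal.hit_eq {n : ℤ} {X : ℕ → ℤ} (hX : Legal X) (h0 : X 0 < n) (hhit : ∃ t, X t = n) :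
    ((hit n X : ℕ∞) : ℝ≥0∞) = ((n - X 0).toNat : ℕ) + backSteps n X := by
  classical
  set t := Nat.find hhit with ht
  have htn : X t = n := Nat.find_spec hhit
  have hlt : ∀ s < t, X s ≠ n := fun s hs => Nat.find_min hhit hs
  have hpos : 0 < t := by
    by_contra h
    have h : t = 0 := by omega
    rw [h] at htn
    omega
  have hh : hit n X = t := by
    refine le_antisymm (iInf₂_le t ⟨hpos, htn⟩) (le_iInf₂ fun s hs => ?_)
    by_contra hcon
    exact hlt s (by exact_mod_cast not_le.1 hcon) hs.2
  rw [hh, ENat.toENNReal_coe, hX.time_eq h0.le htn hlt]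

lemma descProd_nonneg (ω : Env) {i k : ℤ} (h : k ≤ i) (l m : Fin 3) :
    0 ≤ descProd ω i k l m := by
  obtain ⟨M, rfl⟩ : ∃ M : ℕ, k = i - M := ⟨(i - k).toNat, by omega⟩
  rw [descProd_eq_downProd]
  exact downProd_nonneg _ _ _ _ _

/-- The mean number of jumps of each type at level `k` before the first visit of `n`. -/
theorem lintegral_total {ω : Env} (hω : Good ω) (n : ℕ) (k : ℤ) (m : Fin 3) :
    ∫⁻ X, total n k X m ∂(quenched ω 0) =
      ∑ i ∈ Finset.range n, if k ≤ i then ENNReal.ofReal (descProd ω i k 0 m) else 0 := by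
  rcases le_or_gt (n : ℤ) k with hk | hk
  · rw [lintegral_total_eq_zero ω (by omega) hk]
    refine (Finset.sum_eq_zero fun i hi => if_neg ?_).symm
    have := Finset.mem_range.1 hi
    omega
  obtain ⟨j, rfl⟩ : ∃ j : ℕ, k = n - 1 - j := ⟨(n - 1 - k).toNat, by omega⟩
  clear hk
  -- Downward recursion in the level, starting from level `n`, where all counts vanish.
  have step : ∀ k : ℤ, k < n → (∀ l, ∫⁻ X, total n (k + 1) X l ∂(quenched ω 0) =
      ∑ i ∈ Finset.range n, if k + 1 ≤ i then ENNReal.ofReal (descProd ω i (k + 1) 0 l) else 0) →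
      ∀ m, ∫⁻ X, total n k X m ∂(quenched ω 0) =
      ∑ i ∈ Finset.range n, if k ≤ i then ENNReal.ofReal (descProd ω i k 0 m) else 0 := by
    intro k hk ih m
    rw [lintegral_total_mean hω hk m (by omega)]
    simp only [ih, Finset.sum_mul]
    rw [Finset.sum_comm]
    -- The immigrant born into level `k` is written as the summand `i = k`, so that the index `i`
    -- records from which immigrant a line descends.
    have h1 : ∑ i ∈ Finset.range n, (if k = (i : ℤ) then meanMat ω k 0 m else 0) =
        if 0 ≤ k then meanMat ω k 0 m else 0 := by
      split_ifs with h0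
      · lift k to ℕ using h0
        simp only [Nat.cast_inj]
        rw [Finset.sum_ite_eq, if_pos (Finset.mem_range.2 (by omega))]
      · exact Finset.sum_eq_zero fun i _ => if_neg (by omega)
    rw [← h1, ← Finset.sum_add_distrib]
    refine Finset.sum_congr rfl fun i _ => ?_
    rcases lt_trichotomy k (i : ℤ) with h | h | h
    · rw [if_neg h.ne, if_pos h.le, descProd_of_lt ω h, Matrix.mul_apply,
        ENNReal.ofReal_sum_of_nonneg fun l _ =>
          mul_nonneg (descProd_nonneg ω (by omega) _ _) (A_nonneg _ _ _ _), zero_add]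
      refine Finset.sum_congr rfl fun l _ => ?_
      rw [if_pos (by omega), ENNReal.ofReal_mul (descProd_nonneg ω (by omega) _ _)]
      rfl
    · rw [if_pos h, if_pos h.le, h, descProd_self]
      simp [meanMat]
    · rw [if_neg h.ne', if_neg (by omega)]
      simp [show ¬ k + 1 ≤ (i : ℤ) by omega]
  induction j generalizing m with
  | zero =>
    refine step _ (by omega) (fun l => ?_) m
    rw [lintegral_total_eq_zero ω (by omega) (by simp)]
    refine (Finset.sum_eq_zero fun i hi => if_neg ?_).symm
    have := Finset.mem_range.1 hi
    push_cast
    omega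
  | succ j ih =>
    refine step _ (by omega) (fun l => ?_) m
    have e : (n : ℤ) - 1 - ((j + 1 : ℕ) : ℤ) + 1 = n - 1 - j := by push_cast; ring
    rw [e]
    exact ih l

/-- Integrates the pathwise identity `Legal.hit_eq`. All terms are nonnegative, so the sums and the
integral may be exchanged and the equality holds in `[0, ∞]`, even when the mean is infinite. -/
theorem lintegral_hit {ω : Env} (hω : Good ω) {n : ℕ} (hn : 1 ≤ n) :
    ∫⁻ X, ((hit n X : ℕ∞) : ℝ≥0∞) ∂(quenched ω 0) =
      (n : ℝ≥0∞) + ∑ i ∈ Finset.range n, ∑' k : Set.Iic (i : ℤ),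
        ENNReal.ofReal ((Pi.single 0 1 : Fin 3 → ℝ) ⬝ᵥ
          (descProd ω (i : ℤ) (k : ℤ) *ᵥ ![2, 1, 2])) := by
  have h1 : ∫⁻ X, ((hit n X : ℕ∞) : ℝ≥0∞) ∂(quenched ω 0) =
      ∫⁻ X, ((n : ℝ≥0∞) + backSteps n X) ∂(quenched ω 0) := by
    refine lintegral_congr_ae ?_
    filter_upwards [ae_legal ω 0, ae_start ω 0, ae_exists_hit hω (n := n) (x := 0) (by omega)]
      with X hX h0 hhit
    rw [hX.hit_eq (by omega) hhit, h0]
    simp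
  have h2 : ∀ i : ℕ, ∑' k : Set.Iic (i : ℤ), ENNReal.ofReal ((Pi.single 0 1 : Fin 3 → ℝ) ⬝ᵥ
      (descProd ω (i : ℤ) (k : ℤ) *ᵥ ![2, 1, 2])) =
      ∑' k : ℤ, (2 * (if k ≤ i then ENNReal.ofReal (descProd ω i k 0 0) else 0) +
        (if k ≤ i then ENNReal.ofReal (descProd ω i k 0 1) else 0) +
        2 * (if k ≤ i then ENNReal.ofReal (descProd ω i k 0 2) else 0)) := fun i => by
    rw [tsum_subtype (Set.Iic (i : ℤ)) fun k => ENNReal.ofReal ((Pi.single 0 1 : Fin 3 → ℝ) ⬝ᵥ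
      (descProd ω (i : ℤ) k *ᵥ ![2, 1, 2]))]
    refine tsum_congr fun k => ?_
    by_cases hk : k ≤ (i : ℤ)
    · have hd := descProd_nonneg ω hk 0
      rw [Set.indicator_of_mem (Set.mem_Iic.2 hk), single_one_dotProduct, Matrix.mulVec,
        dotProduct, Fin.sum_univ_three]
      simp only [hk, if_true, Matrix.cons_val_zero, Matrix.cons_val_one, Matrix.cons_val]
      have h0 := hd 0
      have h1 := hd 1
      have h2 := hd 2
      rw [ENNReal.ofReal_add (by positivity) (by positivity),
        ENNReal.ofReal_add (by positivity) (by positivity), ENNReal.ofReal_mul h0,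
        ENNReal.ofReal_mul h2, mul_one, ENNReal.ofReal_ofNat]
      ring
    · rw [Set.indicator_of_notMem (by simpa using hk)]
      simp [hk]
  rw [h1, lintegral_add_left measurable_const, lintegral_const, measure_univ, mul_one]
  congr 1
  simp only [h2]
  rw [← Summable.tsum_finsetSum fun _ _ => ENNReal.summable]
  simp only [backSteps]
  rw [lintegral_tsum fun k => by fun_prop]
  refine tsum_congr fun k => ?_
  rw [lintegral_add_left (by fun_prop), lintegral_add_left (by fun_prop),
    lintegral_const_mul _ (by fun_prop), lintegral_const_mul _ (by fun_prop), lintegral_total hω,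
    lintegral_total hω, lintegral_total hω]
  simp only [Finset.sum_add_distrib, Finset.mul_sum]

end RWRE21

end

theorem mainTheorem10
    (ν : Measure RWRE21.JumpLaw) [IsProbabilityMeasure ν]
    (hC1 : RWRE21.C1 ν) (hC2 : RWRE21.C2 ν) :
    ∀ᵐ ω ∂(RWRE21.envLaw ν),
      (∀ i : ℤ, RWRE21.meanOffspring ω i = (RWRE21.A ω i).map ENNReal.ofReal) ∧
      (∀ n : ℕ, 1 ≤ n → ∀ i : ℤ, i < n → ∀ u : Fin 3 → ℕ,
        RWRE21.quenched ω 0 (RWRE21.levelEvent n (i + 1) u) ≠ 0 →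
        ∀ m : Fin 3,
          ∫⁻ X, ((RWRE21.U n i X m : ℕ∞) : ℝ≥0∞)
              ∂((RWRE21.quenched ω 0)[|RWRE21.levelEvent n (i + 1) u]) =
            ENNReal.ofReal
              ((((fun l => (u l : ℝ)) + RWRE21.immigrant i) ᵥ* RWRE21.A ω i) m)) ∧
      (∀ n : ℕ, 1 ≤ n →
        ∫⁻ X, ((RWRE21.hit n X : ℕ∞) : ℝ≥0∞) ∂(RWRE21.quenched ω 0) =
          (n : ℝ≥0∞) + ∑ i ∈ Finset.range n, ∑' k : Set.Iic (i : ℤ),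
            ENNReal.ofReal
              ((Pi.single 0 1 : Fin 3 → ℝ) ⬝ᵥ
                (RWRE21.descProd ω (i : ℤ) (k : ℤ) *ᵥ ![2, 1, 2]))) := by
  filter_upwards [RWRE21.ae_good ν hC1 hC2] with ω hω
  exact ⟨RWRE21.meanOffspring_eq hω,
    fun n hn i hi u hu m => RWRE21.lintegral_cond_levelEvent hω hn hi u hu m,
    fun n hn => RWRE21.lintegral_hit hω hn⟩
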